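/- For every $d\ge 0$ and $D\ge 0$ there is a constant $C=C_{d,D}>0$ with the following property. Let $\delta>0$, let $\vec N=(N_1,\dots,N_D)$ with real $N_i\ge 1$, and let $P(x)=\sum_{|\alpha|\le d}\lambda_\alpha x^\alpha\in\mathbb R[x_1,\dots,x_D]$ be a real polynomial of degree at most $d$. Write $e(t)=e^{2\pi i t}$, $|\vec N|=\prod_i N_i$, $\vec N^\alpha=\prod_i N_i^{\alpha_i}$, and $\|x\|_{\mathbb T}=\min_{n\in\mathbb Z}|x-n|$. For each $i$ let $\mathcal P_i\subset[-N_i,N_i]\cap\mathbb Z$ be a finite arithmetic progression whose gap size $\sigma_i=\min_{p\ne p'\in\mathcal P_i}|p-p'|$ satisfies $\sigma_i\le\delta^{-1}$ (no condition if $\mathcal P_i$ has at most one element). Suppose that $$\Bigl|\frac1{|\vec N|}\sum_{n\in\mathcal P_1\times\dots\times\mathcal P_D}e(P(n))\Bigr|\ge\delta .$$ Then at least one of the following holds: - $N_i\le C\delta^{-C}$ for some $i$; or - there is an integer $1\le Q\le C\delta^{-C}$ such that, for every multi-index $\alpha$, $\displaystyle \|Q\lambda_\alpha\|_{\mathbb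 T}\le\frac{C\delta^{-C}}{\vec N^{\alpha}}$. (For $\delta\le\frac12$ each bound $C\delta^{-C}$ is of the form $\delta^{-O_{d,D}(1)}$.) -/

import Mathlib

noncomputable section

namespace ExpSum

/-- The complex exponential `e(t) = exp(2πit)`. -/
def e (t : ℝ) : ℂ := Complex.exp (2 * Real.pi * Complex.I * t)

/-- `S` is a finite arithmetic progression of integers `{a, a + q, …, a + (L - 1) q}`, `q ≥ 1`. -/
def IsArithProg (S : Finset ℤ) : Prop :=
  ∃ (a : ℤ) (q L : ℕ), 1 ≤ q ∧
    S = (Finset.range L).image (fun k : ℕ => a + (k : ℤ) * (q : ℤ))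

/-- The gap size `min {|p - p'| : p ≠ p' ∈ S}`. If `S` has at most one element there is no pair
to minimise over and the value is `0`, so that an upper bound on the gap is then no restriction. -/
def gap (S : Finset ℤ) : ℕ :=
  sInf {k : ℕ | ∃ p ∈ S, ∃ p' ∈ S, p ≠ p' ∧ k = (p - p').natAbs}

/-- The volume `|N| = N₁ ⋯ N_D`. -/
def vol {D : ℕ} (N : Fin D → ℝ) : ℝ := ∏ i, N i

/-- The monomial `N ^ α = ∏ᵢ Nᵢ ^ αᵢ`. -/
def monom {D : ℕ} (N : Fin D → ℝ) (α : Fin D →₀ ℕ) : ℝ := ∏ i, N i ^ α i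

/-- The norm on the torus, `‖x‖_𝕋`, the distance from `x` to the nearest integer. -/
def torusNorm (x : ℝ) : ℝ := ‖(x : UnitAddCircle)‖

/-- The normalized exponential sum `|N|⁻¹ ∑ e(P(n))`, over `n` with `nᵢ ∈ Sᵢ` for all `i`. -/
def normalizedSum {D : ℕ} (N : Fin D → ℝ) (S : Fin D → Finset ℤ) (P : MvPolynomial (Fin D) ℝ) :
    ℂ :=
  (1 / (vol N : ℂ)) *
    ∑ n ∈ Fintype.piFinset S, e (MvPolynomial.eval (fun i => (n i : ℝ)) P)

end ExpSum

end

open Finset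

namespace ExpSum

/-! ### The torus norm -/

/-! All losses are powers of K = 2/δ; constants depending on d and D are absorbed into such powers.
Call a coefficient of degree j structured if some positive integer Q ≤ K^O(1) brings Q times it
within K^O(1)/N^j of an integer.

In one variable (`WeylBound`) the induction is on the degree. Squaring the sum and grouping pairs by
their difference h shows that e(f(n+h) - f(n)) has a large sum for many h. This phase has lower
degree and linear coefficient f'(h) - f'(0), so by induction that number is close to a rational for
many h. As a polynomial in h, f' - f'(0) is thus often close to an integer after multiplication by
one common denominator, and `PolyRecurrence` makes every coefficient of f of degree at least 2
structured. The linear coefficient has cancelled; it is recovered on a short progression whose step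
is a multiple of the denominator just found. There f is almost linear, and a large geometric sum
forces its slope close to an integer.

`PolyRecurrence` also goes by differencing, applied to the set where f is close to an integer: the
top coefficient times h is close to a rational for many h, Vinogradov's lemma `linear_recurrence`
treats it, and the top monomial is subtracted. The output error is proportional to ε, so an input
error already of size 1/N^j keeps that gain.

In several variables (`MvWeylBound`) the induction is on D. Write P as a sum of x^j p_j(n), where x
is the first variable. For many n the slice in x has a large sum, so for j ≥ 1 the value p_j(n) is
close to a rational; `MvRecurrence` passes from these values to the coefficients of p_j. For j = 0
the slice gives no information: x is fixed so that the sum over n is large, induction applies to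
P(x, ·), and the known terms with j ≥ 1 are subtracted. -/

theorem torusNorm_eq (x : ℝ) : torusNorm x = |x - round x| := by
  unfold torusNorm
  exact UnitAddCircle.norm_eq

theorem torusNorm_nonneg (x : ℝ) : 0 ≤ torusNorm x := norm_nonneg _

theorem torusNorm_zero : torusNorm 0 = 0 := by simp [torusNorm]

theorem torusNorm_add_le (x y : ℝ) : torusNorm (x + y) ≤ torusNorm x + torusNorm y := by
  unfold torusNorm
  rw [AddCircle.coe_add]
  exact norm_add_le _ _

theorem torusNorm_sub_le (x y : ℝ) : torusNorm (x - y) ≤ torusNorm x + torusNorm y := by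
  unfold torusNorm
  rw [AddCircle.coe_sub]
  exact norm_sub_le _ _

theorem torusNorm_neg (x : ℝ) : torusNorm (-x) = torusNorm x := by
  unfold torusNorm
  rw [AddCircle.coe_neg, norm_neg]

theorem torusNorm_sum_le {ι : Type*} (s : Finset ι) (f : ι → ℝ) :
    torusNorm (∑ i ∈ s, f i) ≤ ∑ i ∈ s, torusNorm (f i) := by
  classical
  induction s using Finset.induction_on with
  | empty => simp [torusNorm_zero]
  | insert a s ha ih =>
    rw [Finset.sum_insert ha, Finset.sum_insert ha]
    exact (torusNorm_add_le _ _).trans (by gcongr)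

theorem torusNorm_le_half (x : ℝ) : torusNorm x ≤ 1 / 2 := by
  rw [torusNorm_eq]; exact abs_sub_round x

theorem torusNorm_le_abs (x : ℝ) : torusNorm x ≤ |x| := by
  rw [torusNorm_eq]
  simpa using round_le x 0

theorem torusNorm_of_abs_le_half {x : ℝ} (hx : |x| ≤ 1 / 2) : torusNorm x = |x| := by
  apply le_antisymm (torusNorm_le_abs x)
  rw [torusNorm_eq]
  by_cases h : round x = 0
  · simp [h]
  · have h1 : (1 : ℝ) ≤ |(round x : ℝ)| := by exact_mod_cast Int.one_le_abs h
    have h2 : |(round x : ℝ)| ≤ |x - round x| + |x| := by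
      have := abs_sub_abs_le_abs_sub (round x : ℝ) x
      rw [abs_sub_comm] at this
      linarith
    linarith

theorem torusNorm_int_mul_le (m : ℤ) (x : ℝ) : torusNorm (m * x) ≤ |(m : ℝ)| * torusNorm x := by
  unfold torusNorm
  have : ((m * x : ℝ) : UnitAddCircle) = m • (x : UnitAddCircle) := by
    rw [← zsmul_eq_mul, AddCircle.coe_zsmul]
  rw [this]
  have := norm_zsmul_le (n := m) (a := (x : UnitAddCircle))
  rwa [Int.norm_eq_abs] at this

theorem torusNorm_nat_mul_le (m : ℕ) (x : ℝ) : torusNorm (m * x) ≤ m * torusNorm x := by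
  simpa using torusNorm_int_mul_le m x

theorem torusNorm_intCast (m : ℤ) : torusNorm (m : ℝ) = 0 := by
  simp [torusNorm_eq]

theorem torusNorm_add_intCast (x : ℝ) (m : ℤ) : torusNorm (x + m) = torusNorm x := by
  apply le_antisymm
  · simpa [torusNorm_intCast] using torusNorm_add_le x m
  · simpa [torusNorm_intCast] using torusNorm_sub_le (x + m) m

theorem torusNorm_mul_sub_round (x : ℝ) (m : ℤ) :
    torusNorm (m * (x - round x)) = torusNorm (m * x) := by
  have : (m : ℝ) * x = m * (x - round x) + ((m * round x : ℤ) : ℝ) := by push_cast; ring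
  rw [this, torusNorm_add_intCast]

/-! ### The complex exponential -/

theorem e_add (x y : ℝ) : e (x + y) = e x * e y := by
  unfold e
  rw [← Complex.exp_add]
  congr 1
  push_cast
  ring

theorem e_eq (x : ℝ) : e x = Complex.exp (Complex.I * ((2 * Real.pi * x : ℝ) : ℂ)) := by
  unfold e
  congr 1
  push_cast
  ring

theorem norm_e (x : ℝ) : ‖e x‖ = 1 := by
  rw [e_eq, mul_comm, Complex.norm_exp_ofReal_mul_I]

theorem e_intCast (m : ℤ) : e m = 1 := by
  unfold e
  rw [Complex.exp_eq_one_iff]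
  exact ⟨m, by push_cast; ring⟩

theorem e_zero : e 0 = 1 := by simpa using e_intCast 0

theorem e_sub (x y : ℝ) : e (x - y) = e x * (starRingEnd ℂ) (e y) := by
  have h : e (x - y) * e y = e x := by rw [← e_add]; simp
  have h2 : e y * (starRingEnd ℂ) (e y) = 1 := by
    rw [Complex.mul_conj, Complex.normSq_eq_norm_sq, norm_e]; simp
  rw [← h, mul_assoc, h2, mul_one]

theorem e_sub_round (x : ℝ) : e (x - round x) = e x := by
  rw [e_sub, e_intCast]; simp

theorem norm_e_sub_one (x : ℝ) : ‖e x - 1‖ = 2 * |Real.sin (Real.pi * x)| := by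
  rw [e_eq, Complex.norm_exp_I_mul_ofReal_sub_one]
  rw [show 2 * Real.pi * x / 2 = Real.pi * x by ring, Real.norm_eq_abs, abs_mul]
  simp

theorem norm_e_sub_one_le (x : ℝ) : ‖e x - 1‖ ≤ 8 * torusNorm x := by
  rw [← e_sub_round, norm_e_sub_one, torusNorm_eq]
  have h1 : |Real.sin (Real.pi * (x - round x))| ≤ |Real.pi * (x - round x)| := Real.abs_sin_le_abs
  rw [abs_mul, abs_of_pos Real.pi_pos] at h1
  nlinarith [Real.pi_le_four, abs_nonneg (x - round x)]

theorem le_norm_e_sub_one (x : ℝ) : 4 * torusNorm x ≤ ‖e x - 1‖ := by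
  rw [← e_sub_round, norm_e_sub_one, torusNorm_eq]
  have h0 := abs_sub_round x
  have h1 : 2 / Real.pi * |Real.pi * (x - round x)| ≤ |Real.sin (Real.pi * (x - round x))| := by
    apply Real.mul_abs_le_abs_sin
    rw [abs_mul, abs_of_pos Real.pi_pos]
    nlinarith [Real.pi_pos]
  rw [abs_mul, abs_of_pos Real.pi_pos] at h1
  have h2 : 2 / Real.pi * (Real.pi * |x - round x|) = 2 * |x - round x| := by
    field_simp
  linarith

theorem norm_e_sub_e_le (x y : ℝ) : ‖e x - e y‖ ≤ 8 * torusNorm (x - y) := by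
  have h : e x - e y = (e (x - y) - 1) * e y := by
    rw [sub_mul, ← e_add]; simp
  rw [h, norm_mul, norm_e, mul_one]
  exact norm_e_sub_one_le _

/-- Multiplying by e(θ) - 1 telescopes the sum to a quantity of norm at most 2, while |e(θ) - 1| is
at least four times the torus norm of θ. -/
theorem norm_geom_sum_e_mul_torusNorm_le (θ : ℝ) (M : ℕ) :
    ‖∑ k ∈ range M, e (k * θ)‖ * torusNorm θ ≤ 1 := by
  have hpow : ∀ k : ℕ, e (k * θ) = e θ ^ k := by
    intro k
    induction k with
    | zero => simp [e_zero]
    | succ k ih => rw [pow_succ, ← ih, ← e_add]; congr 1; push_cast; ring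
  have h1 : (∑ k ∈ range M, e (k * θ)) * (e θ - 1) = e (M * θ) - 1 := by
    simp_rw [hpow]
    exact geom_sum_mul _ _
  have h2 : ‖∑ k ∈ range M, e (k * θ)‖ * ‖e θ - 1‖ ≤ 2 := by
    rw [← norm_mul, h1]
    refine (norm_sub_le _ _).trans ?_
    rw [norm_e, norm_one]
    norm_num
  have h3 := le_norm_e_sub_one θ
  have h4 := norm_nonneg (∑ k ∈ range M, e (k * θ))
  nlinarith [mul_le_mul_of_nonneg_left h3 h4]

/-! ### Counting and pigeonholing -/

/-- The hypothesis only makes the right side nonnegative, which covers the case where no integer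
lies between a and b. -/
theorem card_Icc_ceil_floor_le {a b : ℝ} (hab : a ≤ b + 1) : ((Icc ⌈a⌉ ⌊b⌋).card : ℝ) ≤ b - a + 1 := by
  rw [Int.card_Icc]
  have h1 : ((⌊b⌋ + 1 - ⌈a⌉).toNat : ℝ) = max ((⌊b⌋ + 1 - ⌈a⌉ : ℤ) : ℝ) 0 := by
    have : (((⌊b⌋ + 1 - ⌈a⌉).toNat : ℤ) : ℝ) = ((max (⌊b⌋ + 1 - ⌈a⌉) 0 : ℤ) : ℝ) := by
      rw [Int.toNat_eq_max]
    rw [Int.cast_natCast] at this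
    rw [this]
    push_cast
    rfl
  rw [h1]
  apply max_le
  · push_cast
    linarith [Int.floor_le b, Int.le_ceil a]
  · linarith

theorem card_le_of_mem_interval (S : Finset ℤ) {a b : ℝ} (hab : a ≤ b + 1)
    (h : ∀ n ∈ S, a ≤ (n : ℝ) ∧ (n : ℝ) ≤ b) : (S.card : ℝ) ≤ b - a + 1 := by
  refine le_trans ?_ (card_Icc_ceil_floor_le hab)
  have : S ⊆ Icc ⌈a⌉ ⌊b⌋ := by
    intro n hn
    rw [mem_Icc]
    exact ⟨Int.ceil_le.2 (h n hn).1, Int.le_floor.2 (h n hn).2⟩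
  exact_mod_cast card_le_card this

theorem card_le_three_mul (S : Finset ℤ) {N : ℝ} (hN : 1 ≤ N) (h : ∀ n ∈ S, |(n : ℝ)| ≤ N) :
    (S.card : ℝ) ≤ 3 * N := by
  have := card_le_of_mem_interval S (a := -N) (b := N) (by linarith) (fun n hn => abs_le.1 (h n hn))
  linarith

theorem sum_le_mul_card_filter_add {ι : Type*} (X : Finset ι) (g : ι → ℝ) {B τ : ℝ} (hτ : 0 ≤ τ)
    (hB : ∀ x ∈ X, g x ≤ B) :
    ∑ x ∈ X, g x ≤ B * ((X.filter (fun x => τ ≤ g x)).card : ℝ) + τ * X.card := by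
  rw [← sum_filter_add_sum_filter_not X (fun x => τ ≤ g x)]
  apply add_le_add
  · rw [mul_comm, ← nsmul_eq_mul]
    exact sum_le_card_nsmul _ _ _ (fun x hx => hB x (mem_filter.1 hx).1)
  · have h1 : ∑ x ∈ X with ¬ τ ≤ g x, g x ≤ (X.filter (fun x => ¬ τ ≤ g x)).card • τ :=
      sum_le_card_nsmul _ _ _ (fun x hx => (not_le.1 (mem_filter.1 hx).2).le)
    refine h1.trans ?_
    rw [nsmul_eq_mul, mul_comm]
    gcongr
    exact filter_subset _ _

/-- Pigeonhole over the at most M possible denominators: making Q independent of the point costs a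
factor M in cardinality. -/
theorem exists_common_denominator {ι : Type*} (A : Finset ι) (hA : A.Nonempty) {M : ℝ}
    (p : ℕ → ι → Prop) (h : ∀ a ∈ A, ∃ Q : ℕ, 1 ≤ Q ∧ (Q : ℝ) ≤ M ∧ p Q a) :
    ∃ Q : ℕ, 1 ≤ Q ∧ (Q : ℝ) ≤ M ∧ ∃ A' ⊆ A, (A.card : ℝ) ≤ M * A'.card ∧ ∀ a ∈ A', p Q a := by
  classical
  choose! Q h1 h2 h3 using h
  obtain ⟨a0, ha0⟩ := hA
  have hM : (1 : ℝ) ≤ M := le_trans (by exact_mod_cast h1 a0 ha0) (h2 a0 ha0)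
  have hmaps : ∀ a ∈ A, Q a ∈ Icc 1 ⌊M⌋₊ := fun a ha =>
    mem_Icc.2 ⟨h1 a ha, Nat.le_floor (h2 a ha)⟩
  have hfl : (⌊M⌋₊ : ℝ) ≤ M := Nat.floor_le (by linarith)
  have hfl1 : 1 ≤ ⌊M⌋₊ := Nat.le_floor (by simpa using hM)
  obtain ⟨q, hq, hcard⟩ := exists_le_card_fiber_of_nsmul_le_card_of_maps_to (s := A)
    (t := Icc 1 ⌊M⌋₊) (f := Q) (b := (A.card : ℝ) / ⌊M⌋₊) hmaps ⟨1, mem_Icc.2 ⟨le_rfl, hfl1⟩⟩ (by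
      rw [Nat.card_Icc, nsmul_eq_mul]
      have : (0 : ℝ) < ⌊M⌋₊ := by exact_mod_cast hfl1
      simp only [Nat.add_sub_cancel]
      field_simp
      exact le_rfl)
  rw [mem_Icc] at hq
  refine ⟨q, hq.1, le_trans (by exact_mod_cast hq.2) hfl, A.filter (fun a => Q a = q),
    filter_subset _ _, ?_, ?_⟩
  · rw [div_le_iff₀ (by exact_mod_cast hfl1)] at hcard
    refine hcard.trans ?_
    rw [mul_comm]
    gcongr
  · intro a ha
    rw [mem_filter] at ha
    exact ha.2 ▸ h3 a ha.1

/-- Absorbs numerical constants into powers of K, so that only exponents need to be tracked. -/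
theorem natCast_le_pow {K : ℝ} (hK : 2 ≤ K) (c : ℕ) : (c : ℝ) ≤ K ^ c := by
  calc (c : ℝ) ≤ 2 ^ c := by exact_mod_cast Nat.lt_two_pow_self.le
    _ ≤ K ^ c := by gcongr

/-! ### Recurrence of linear and polynomial phases -/

/-- A set of density 1/K has two elements at distance O(K), and their difference serves as Q. The
resulting bound lacks the factor 1/N, which the next lemmas supply. -/
theorem exists_torusNorm_le_of_close {K N ε α : ℝ} (hK : 2 ≤ K) (hN : K ^ 20 ≤ N) (H : Finset ℤ)
    (hH : ∀ h ∈ H, |(h : ℝ)| ≤ N) (hcard : N ≤ K * H.card)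
    (hα : ∀ h ∈ H, torusNorm (h * α) ≤ ε) :
    ∃ Q : ℕ, 1 ≤ Q ∧ (Q : ℝ) ≤ 5 * K ∧ torusNorm (Q * α) ≤ 2 * ε := by
  have hK20 : 64 * K ≤ N := by
    refine le_trans ?_ hN
    calc 64 * K = 2 ^ 6 * K := by norm_num
      _ ≤ K ^ 6 * K := by gcongr
      _ = K ^ 7 := by ring
      _ ≤ K ^ 20 := by apply pow_le_pow_right₀ <;> [linarith; norm_num]
  -- Blocks of length w number at most 2N/w + 2 ≤ N/(2K) + 2, which is less than N/K, so some block
  -- contains two elements of H.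
  set w : ℕ := ⌈4 * K⌉₊ with hw
  have hw1 : 4 * K ≤ w := Nat.le_ceil _
  have hw2 : (w : ℝ) ≤ 5 * K := by
    have := Nat.ceil_lt_add_one (show 0 ≤ 4 * K by linarith)
    linarith
  have hw0 : (0 : ℝ) < w := by linarith
  have himg : ((H.image (fun h => h / (w : ℤ))).card : ℝ) ≤ N / w - (-N / w - 1) + 1 := by
    apply card_le_of_mem_interval
    · have : 0 ≤ N / w := by apply div_nonneg <;> linarith
      have h2 : -N / w = -(N / w) := by ring
      linarith
    · intro n hn
      obtain ⟨h, hh, rfl⟩ := mem_image.1 hn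
      have h1 := abs_le.1 (hH h hh)
      have hfl : ((h / (w : ℤ) : ℤ) : ℝ) = (⌊(h : ℝ) / w⌋ : ℤ) := by
        rw [Int.floor_div_natCast]; simp
      rw [hfl]
      constructor
      · have := (Int.sub_one_lt_floor ((h : ℝ) / w)).le
        have h2 : -N / w ≤ h / w := by gcongr; exact h1.1
        linarith
      · refine (Int.floor_le _).trans ?_
        gcongr
        exact h1.2
  have hlt : (H.image (fun h => h / (w : ℤ))).card < H.card := by
    have h1 : N / w ≤ N / (4 * K) := by gcongr; linarith
    have h2 : N / (4 * K) * (4 * K) = N := by field_simp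
    have h3 : -N / w = -(N / w) := by ring
    have h4 : ((H.image (fun h => h / (w : ℤ))).card : ℝ) < H.card := by
      nlinarith
    exact_mod_cast h4
  obtain ⟨x, hx, y, hy, hxy, hdiv⟩ := exists_ne_map_eq_of_card_lt_of_maps_to hlt
    (fun a ha => mem_image_of_mem (fun h => h / (w : ℤ)) ha)
  have hclose : |x - y| < w := by
    have h1 := Int.mul_ediv_add_emod x w
    have h2 := Int.mul_ediv_add_emod y w
    have hwp : (0 : ℤ) < w := by exact_mod_cast hw0
    have h3 := Int.emod_nonneg x hwp.ne'
    have h4 := Int.emod_nonneg y hwp.ne'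
    have h5 := Int.emod_lt_of_pos x hwp
    have h6 := Int.emod_lt_of_pos y hwp
    rw [hdiv] at h1
    rw [abs_lt]
    constructor <;> linarith
  refine ⟨(x - y).natAbs, ?_, ?_, ?_⟩
  · have := Int.natAbs_pos.2 (sub_ne_zero.2 hxy)
    omega
  · have : ((x - y).natAbs : ℝ) = ((|x - y| : ℤ) : ℝ) := by
      rw [← Int.natCast_natAbs]; simp
    rw [this]
    have h2 : ((|x - y| : ℤ) : ℝ) ≤ ((w : ℤ) : ℝ) := by exact_mod_cast hclose.le
    rw [Int.cast_natCast] at h2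
    linarith
  · have hd : torusNorm ((x - y : ℤ) * α) ≤ 2 * ε := by
      push_cast
      rw [sub_mul]
      have := torusNorm_sub_le (x * α) (y * α)
      linarith [hα x hx, hα y hy]
    rcases Int.natAbs_eq (x - y) with h | h
    · rw [h, Int.cast_natCast] at hd
      exact hd
    · rw [h, Int.cast_neg, neg_mul, torusNorm_neg, Int.cast_natCast] at hd
      exact hd

/-- Differences in F are Q·m with |m| ≤ W, and then |mβ| ≤ 1/2: no wrap-around occurs, so the torus
norm of mβ is |mβ| itself and |m| ≤ 2ε/|β|. -/
theorem card_le_of_fiber_close {β ε : ℝ} (hβ0 : β ≠ 0) (hβ : |β| ≤ 2 * ε) {Q W : ℕ} (hQ : 1 ≤ Q)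
    (hW : (W : ℝ) * |β| ≤ 1 / 2) (F : Finset ℤ)
    (hF : ∀ x ∈ F, ∀ y ∈ F, (Q : ℤ) ∣ x - y ∧ |x - y| ≤ W * Q ∧
      ∀ m : ℤ, x - y = Q * m → torusNorm (m * β) ≤ 2 * ε) :
    (F.card : ℝ) ≤ 6 * ε / |β| := by
  have hβp : 0 < |β| := abs_pos.2 hβ0
  have hε : 0 < ε := by linarith
  have hR : 1 ≤ 2 * ε / |β| := by rw [le_div_iff₀ hβp]; linarith
  rcases F.eq_empty_or_nonempty with rfl | ⟨x0, hx0⟩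
  · simp only [card_empty, Nat.cast_zero]; positivity
  have hQ0 : (Q : ℤ) ≠ 0 := by omega
  have hinj : Set.InjOn (fun x => (x - x0) / (Q : ℤ)) F := by
    intro x hx y hy hxy
    obtain ⟨a, ha⟩ := (hF x hx x0 hx0).1
    obtain ⟨b, hb⟩ := (hF y hy x0 hx0).1
    simp only [ha, hb, Int.mul_ediv_cancel_left _ hQ0] at hxy
    subst hxy
    linarith
  rw [← card_image_of_injOn hinj]
  have h6 : 6 * ε / |β| = 3 * (2 * ε / |β|) := by ring
  rw [h6]
  apply card_le_three_mul _ hR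
  intro m hm
  obtain ⟨x, hx, rfl⟩ := mem_image.1 hm
  obtain ⟨⟨m, hm⟩, h2, h3⟩ := hF x hx x0 hx0
  simp only [hm, Int.mul_ediv_cancel_left _ hQ0]
  have h4 := h3 m hm
  have hmW : |m| ≤ W := by
    rw [hm, abs_mul, Nat.abs_cast, mul_comm] at h2
    exact le_of_mul_le_mul_right h2 (by omega)
  have hmW' : |(m : ℝ)| ≤ W := by exact_mod_cast hmW
  rw [torusNorm_of_abs_le_half, abs_mul] at h4
  · rwa [le_div_iff₀ hβp]
  · rw [abs_mul]
    refine le_trans ?_ hW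
    gcongr

/-- Split H by residue modulo Q and by blocks of length WQ; `card_le_of_fiber_close` bounds each
piece. -/
theorem card_le_of_torusNorm_le {N ε α : ℝ} (hN : 0 ≤ N) {Q W : ℕ} (hQ1 : 1 ≤ Q) (hW0 : 1 ≤ W)
    (hβ0 : (Q : ℝ) * α - round ((Q : ℝ) * α) ≠ 0)
    (hβ : |(Q : ℝ) * α - round ((Q : ℝ) * α)| ≤ 2 * ε)
    (hW1 : (W : ℝ) * |(Q : ℝ) * α - round ((Q : ℝ) * α)| ≤ 1 / 2) (H : Finset ℤ)
    (hH : ∀ h ∈ H, |(h : ℝ)| ≤ N) (hα : ∀ h ∈ H, torusNorm (h * α) ≤ ε) :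
    (H.card : ℝ) ≤ Q * (2 * N / (W * Q) + 2) *
      (6 * ε / |(Q : ℝ) * α - round ((Q : ℝ) * α)|) := by
  have hQ0 : (0 : ℝ) < Q := by exact_mod_cast hQ1
  have hWR : (0 : ℝ) < W := by exact_mod_cast hW0
  have hWQ : (0 : ℝ) < ((W * Q : ℕ) : ℝ) := by push_cast; positivity
  have hWQz : (0 : ℤ) < ((W * Q : ℕ) : ℤ) := by exact_mod_cast hWQ
  set φ : ℤ → ℤ × ℤ := fun h => (h % (Q : ℤ), h / ((W * Q : ℕ) : ℤ)) with hφ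
  set X : Finset (ℤ × ℤ) := Ico 0 (Q : ℤ) ×ˢ H.image (fun h => h / ((W * Q : ℕ) : ℤ)) with hX
  have hmaps : ∀ h ∈ H, φ h ∈ X := by
    intro h hh
    rw [hX, mem_product]
    refine ⟨mem_Ico.2 ⟨Int.emod_nonneg _ (by omega), Int.emod_lt_of_pos _ (by omega)⟩,
      mem_image_of_mem _ hh⟩
  have himg : ((H.image (fun h => h / ((W * Q : ℕ) : ℤ))).card : ℝ) ≤ 2 * N / (W * Q) + 2 := by
    have hb : -N / ((W * Q : ℕ) : ℝ) = -(N / ((W * Q : ℕ) : ℝ)) := by ring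
    have hnn : 0 ≤ N / ((W * Q : ℕ) : ℝ) := by positivity
    have := card_le_of_mem_interval (H.image (fun h => h / ((W * Q : ℕ) : ℤ)))
      (a := -N / ((W * Q : ℕ) : ℝ) - 1) (b := N / ((W * Q : ℕ) : ℝ)) (by linarith) (by
        intro n hn
        obtain ⟨h, hh, rfl⟩ := mem_image.1 hn
        have h1 := abs_le.1 (hH h hh)
        have hfl : ((h / ((W * Q : ℕ) : ℤ) : ℤ) : ℝ) = (⌊(h : ℝ) / ((W * Q : ℕ) : ℝ)⌋ : ℤ) := by
          rw [Int.floor_div_natCast]; simp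
        rw [hfl]
        constructor
        · have := (Int.sub_one_lt_floor ((h : ℝ) / ((W * Q : ℕ) : ℝ))).le
          have h2 : -N / ((W * Q : ℕ) : ℝ) ≤ h / ((W * Q : ℕ) : ℝ) := by gcongr; exact h1.1
          linarith
        · refine (Int.floor_le _).trans ?_
          gcongr
          exact h1.2)
    refine this.trans (le_of_eq ?_)
    push_cast
    ring
  have hXcard : (X.card : ℝ) ≤ Q * (2 * N / (W * Q) + 2) := by
    rw [hX, card_product, Nat.cast_mul]
    rw [Int.card_Ico]
    simp only [sub_zero, Int.toNat_natCast]
    gcongr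
  have hfib : ∀ x ∈ X, (((H.filter (fun h => φ h = x)).card : ℕ) : ℝ) ≤ 6 * ε / |(Q : ℝ) * α - round ((Q : ℝ) * α)| := by
    intro x _
    apply card_le_of_fiber_close hβ0 hβ hQ1 hW1
    intro a ha b hb
    rw [mem_filter] at ha hb
    have hab : φ a = φ b := ha.2.trans hb.2.symm
    simp only [hφ, Prod.mk.injEq] at hab
    refine ⟨Int.ModEq.dvd (Int.ModEq.symm hab.1), ?_, ?_⟩
    · have h1 := Int.mul_ediv_add_emod a ((W * Q : ℕ) : ℤ)
      have h2 := Int.mul_ediv_add_emod b ((W * Q : ℕ) : ℤ)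
      have h3 := Int.emod_nonneg a hWQz.ne'
      have h4 := Int.emod_nonneg b hWQz.ne'
      have h5 := Int.emod_lt_of_pos a hWQz
      have h6 := Int.emod_lt_of_pos b hWQz
      rw [hab.2] at h1
      have h7 : |a - b| ≤ ((W * Q : ℕ) : ℤ) := by
        rw [abs_le]
        constructor <;> linarith
      simpa using h7
    · intro m hm
      rw [torusNorm_mul_sub_round]
      have : (m : ℝ) * (Q * α) = a * α - b * α := by
        have : (a : ℝ) - b = Q * m := by exact_mod_cast hm
        rw [← sub_mul, this]; ring
      rw [this]
      have := torusNorm_sub_le (a * α) (b * α)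
      linarith [hα a ha.1, hα b hb.1]
  have htot : (H.card : ℝ) ≤ Q * (2 * N / (W * Q) + 2) * (6 * ε / |(Q : ℝ) * α - round ((Q : ℝ) * α)|) := by
    rw [card_eq_sum_card_fiberwise hmaps]
    push_cast
    calc ∑ x ∈ X, ((H.filter (fun h => φ h = x)).card : ℝ) ≤ X.card • (6 * ε / |(Q : ℝ) * α - round ((Q : ℝ) * α)|) :=
          sum_le_card_nsmul _ _ _ hfib
      _ = X.card * (6 * ε / |(Q : ℝ) * α - round ((Q : ℝ) * α)|) := nsmul_eq_mul _ _
      _ ≤ _ := mul_le_mul_of_nonneg_right hXcard (by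
        have := hβ.trans' (abs_nonneg _)
        apply div_nonneg <;> [linarith; exact abs_nonneg _])
  exact htot

/-- The count has a term of order εN, which the smallness of ε lets N/2 absorb, and a term of order
Kε/b, which must therefore dominate; solving for b supplies the missing factor 1/N. -/
theorem abs_le_of_card_bound {K N ε b Q W c : ℝ} (hK : 2 ≤ K) (hN1 : 1 ≤ N) (hb : 0 < b)
    (hε0 : 0 ≤ ε) (hεK : ε * (1024 * K ^ 2) ≤ 1) (hQ : 0 < Q) (hQK : Q ≤ 5 * K) (hW0 : 0 < W)
    (hW : 1 / 4 ≤ W * b) (hc : N ≤ K * c)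
    (htot : c ≤ Q * (2 * N / (W * Q) + 2) * (6 * ε / b)) : N * b ≤ 120 * K ^ 2 * ε := by
  have hsimp : Q * (2 * N / (W * Q) + 2) * (6 * ε / b) =
      12 * ε * (N / (W * b)) + 12 * Q * ε / b := by
    field_simp
    ring
  rw [hsimp] at htot
  have hWN : N / (W * b) ≤ 4 * N := by
    rw [div_le_iff₀ (by positivity)]
    nlinarith
  have hfin : c ≤ 48 * ε * N + 60 * K * ε / b := by
    refine htot.trans ?_
    have h1 : 12 * ε * (N / (W * b)) ≤ 12 * ε * (4 * N) := by gcongr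
    have h2 : 12 * Q * ε / b ≤ 12 * (5 * K) * ε / b := by gcongr
    have h3 : 12 * (5 * K) * ε / b = 60 * K * ε / b := by ring
    linarith
  have h8 : N ≤ K * (48 * ε * N + 60 * K * ε / b) := hc.trans (by gcongr)
  have h9 : K * (48 * ε * N) ≤ N / 2 := by
    have h : K * ε * 96 ≤ 1 := by
      have : K * ε * 96 ≤ ε * (1024 * K ^ 2) := by
        have : 0 ≤ ε * K * (K - 2) := by
          apply mul_nonneg <;> [positivity; linarith]
        nlinarith
      linarith
    calc K * (48 * ε * N) = (K * ε * 96) * (N / 2) := by ring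
      _ ≤ 1 * (N / 2) := by gcongr
      _ = N / 2 := one_mul _
  have h10 : N / 2 ≤ 60 * K ^ 2 * ε / b := by
    have : K * (48 * ε * N + 60 * K * ε / b) = K * (48 * ε * N) + 60 * K ^ 2 * ε / b := by
      ring
    linarith
  rw [le_div_iff₀ hb] at h10
  linarith

/-- Vinogradov's lemma: a linear phase that is often close to an integer is close to a rational
of small height. -/
theorem linear_recurrence {K N ε α : ℝ} (hK : 2 ≤ K) (hN : K ^ 20 ≤ N) (hε : ε * K ^ 20 ≤ 1)
    (hε0 : 0 ≤ ε) (H : Finset ℤ)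
    (hH : ∀ h ∈ H, |(h : ℝ)| ≤ N) (hcard : N ≤ K * H.card)
    (hα : ∀ h ∈ H, torusNorm (h * α) ≤ ε) :
    ∃ Q : ℕ, 1 ≤ Q ∧ (Q : ℝ) ≤ K ^ 20 ∧ torusNorm (Q * α) ≤ ε * K ^ 20 / N := by
  have hpow : ∀ a ≤ 20, K ^ a ≤ K ^ 20 := fun a ha => pow_le_pow_right₀ (by linarith) ha
  have hK12 : 1024 * K ^ 2 ≤ K ^ 20 := by
    calc 1024 * K ^ 2 = 2 ^ 10 * K ^ 2 := by norm_num
      _ ≤ K ^ 10 * K ^ 2 := by gcongr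
      _ = K ^ 12 := by ring
      _ ≤ K ^ 20 := hpow _ (by norm_num)
  have hN1 : 1 ≤ N := by nlinarith
  obtain ⟨Q, hQ1, hQK, hQα⟩ := exists_torusNorm_le_of_close hK hN H hH hcard hα
  refine ⟨Q, hQ1, by nlinarith, ?_⟩
  set β := (Q : ℝ) * α - round ((Q : ℝ) * α) with hβ
  have hTβ : torusNorm (Q * α) = |β| := torusNorm_eq _
  rw [hTβ] at hQα ⊢
  by_cases hβ0 : β = 0
  · rw [hβ0, abs_zero]; positivity
  have hβp : 0 < |β| := abs_pos.2 hβ0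
  have hεp : 0 < ε := by linarith
  have hεK : ε * (1024 * K ^ 2) ≤ 1 := (mul_le_mul_of_nonneg_left hK12 hε0).trans hε
  have hε1 : ε * 4096 ≤ 1 := by
    have : 0 ≤ ε * (K ^ 2 - 4) := mul_nonneg hε0 (by nlinarith)
    linarith
  -- The largest number of steps β for which no wrap-around is possible; since β is small, W|β| lies
  -- between 1/4 and 1/2.
  set W : ℕ := ⌊1 / (2 * |β|)⌋₊ with hW
  have hW1 : (W : ℝ) * |β| ≤ 1 / 2 := by
    have := Nat.floor_le (show 0 ≤ 1 / (2 * |β|) by positivity)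
    calc (W : ℝ) * |β| ≤ 1 / (2 * |β|) * |β| := by gcongr
      _ = 1 / 2 := by field_simp
  have hW2 : 1 / 4 ≤ (W : ℝ) * |β| := by
    have := Nat.lt_floor_add_one (1 / (2 * |β|))
    rw [div_lt_iff₀ (by positivity)] at this
    nlinarith
  have hW0 : (0 : ℝ) < W := by
    by_contra h
    have : (W : ℝ) * |β| ≤ 0 := mul_nonpos_of_nonpos_of_nonneg (not_lt.1 h) hβp.le
    linarith
  have htot := card_le_of_torusNorm_le (by linarith) hQ1 (by exact_mod_cast hW0) hβ0 hQα hW1 H hH hα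
  have h10 := abs_le_of_card_bound hK hN1 hβp hε0 hεK (by exact_mod_cast hQ1) hQK hW0 hW2 hcard htot
  rw [le_div_iff₀ (by linarith)]
  have : 120 * K ^ 2 * ε ≤ ε * (1024 * K ^ 2) := by nlinarith [mul_nonneg hε0 (sq_nonneg K)]
  nlinarith

/-! ### Differencing -/

theorem sum_sum_eq_sum_shift {M : Type*} [AddCommMonoid M] (S : Finset ℤ) {N : ℝ}
    (hS : ∀ n ∈ S, |(n : ℝ)| ≤ N) (g : ℤ → ℤ → M) :
    ∑ n ∈ S, ∑ m ∈ S, g n m =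
      ∑ h ∈ Icc ⌈-(2 * N)⌉ ⌊2 * N⌋, ∑ n ∈ S.filter (fun n => n + h ∈ S), g n (n + h) := by
  have h1 : ∀ n ∈ S, ∑ m ∈ S, g n m =
      ∑ h ∈ Icc ⌈-(2 * N)⌉ ⌊2 * N⌋, if n + h ∈ S then g n (n + h) else 0 := by
    intro n hn
    rw [← sum_filter]
    refine sum_nbij' (fun m => m - n) (fun h => n + h) ?_ ?_ ?_ ?_ ?_
    · intro m hm
      have h1 := abs_le.1 (hS n hn)
      have h2 := abs_le.1 (hS m hm)
      rw [mem_filter, mem_Icc, Int.ceil_le, Int.le_floor]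
      push_cast
      refine ⟨⟨by linarith, by linarith⟩, by simpa using hm⟩
    · intro h hh
      exact (mem_filter.1 hh).2
    · intro m _; ring
    · intro h _; ring
    · intro m _; simp
  rw [sum_congr rfl h1, sum_comm]
  refine sum_congr rfl fun h _ => ?_
  rw [sum_filter]

/-- There are at most 5N shifts. Those with g below N/K^6 contribute at most half of N²/K², so the
rest carry the other half, each contributing at most 3N. -/
theorem card_popular_shift {K N : ℝ} (hK : 2 ≤ K) (hN : 1 ≤ N) (g : ℤ → ℝ)
    (hg : ∀ h, g h ≤ 3 * N) (hsum : N ^ 2 / K ^ 2 ≤ ∑ h ∈ Icc ⌈-(2 * N)⌉ ⌊2 * N⌋, g h) :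
    N ≤ K ^ 5 * (((Icc ⌈-(2 * N)⌉ ⌊2 * N⌋).filter (fun h => N / K ^ 6 ≤ g h)).card : ℝ) := by
  have hK0 : 0 < K := by linarith
  have h1 := sum_le_mul_card_filter_add (Icc ⌈-(2 * N)⌉ ⌊2 * N⌋) g (B := 3 * N) (τ := N / K ^ 6)
    (by positivity) (fun h _ => hg h)
  have h2 : ((Icc ⌈-(2 * N)⌉ ⌊2 * N⌋).card : ℝ) ≤ 5 * N :=
    (card_Icc_ceil_floor_le (by linarith)).trans (by linarith)
  have hK4 : 16 ≤ K ^ 4 := by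
    calc (16 : ℝ) = 2 ^ 4 := by norm_num
      _ ≤ K ^ 4 := by gcongr
  have hK3 : 8 ≤ K ^ 3 := by
    calc (8 : ℝ) = 2 ^ 3 := by norm_num
      _ ≤ K ^ 3 := by gcongr
  set G := (((Icc ⌈-(2 * N)⌉ ⌊2 * N⌋).filter (fun h => N / K ^ 6 ≤ g h)).card : ℝ) with hG
  have hG0 : 0 ≤ G := Nat.cast_nonneg _
  have h3 : N / K ^ 6 * ((Icc ⌈-(2 * N)⌉ ⌊2 * N⌋).card : ℝ) ≤ N ^ 2 / K ^ 2 / 2 := by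
    calc N / K ^ 6 * ((Icc ⌈-(2 * N)⌉ ⌊2 * N⌋).card : ℝ) ≤ N / K ^ 6 * (5 * N) := by gcongr
      _ = N ^ 2 / K ^ 2 * (5 / K ^ 4) := by field_simp
      _ ≤ N ^ 2 / K ^ 2 * (1 / 2) := by
        apply mul_le_mul_of_nonneg_left _ (by positivity)
        rw [div_le_iff₀ (by positivity)]
        linarith
      _ = _ := by ring
  have h4 : N ^ 2 / K ^ 2 ≤ 6 * N * G := by linarith
  rw [div_le_iff₀ (by positivity)] at h4
  have h5 : N ≤ 6 * G * K ^ 2 := by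
    have : N * N ≤ N * (6 * G * K ^ 2) := by nlinarith
    exact le_of_mul_le_mul_left this (by linarith)
  calc N ≤ 6 * G * K ^ 2 := h5
    _ ≤ K ^ 3 * G * K ^ 2 := by gcongr; linarith
    _ = _ := by ring

open Polynomial in
theorem taylor_sub_self_coeff_one (f : Polynomial ℝ) (h : ℝ) :
    (taylor h f - f).coeff 1 = f.derivative.eval h - f.coeff 1 := by
  rw [coeff_sub, taylor_coeff_one]

open Polynomial in
theorem taylor_sub_self_coeff {f : Polynomial ℝ} {d : ℕ} (hf : f.natDegree ≤ d + 1) (h : ℝ) :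
    (taylor h f - f).coeff d = h * ((d + 1) * f.coeff (d + 1)) := by
  -- The Taylor coefficient is a Hasse derivative evaluated at h. It has degree at most 1 in h, and
  -- its constant term cancels against f.
  have h1 : (hasseDeriv d f).natDegree < 2 := by
    have := natDegree_hasseDeriv_le f d
    omega
  rw [coeff_sub, taylor_coeff, eval_eq_sum_range' h1]
  simp only [hasseDeriv_coeff, sum_range_succ, range_zero, sum_empty]
  rw [show 1 + d = d + 1 by ring, Nat.choose_succ_self_right]
  push_cast
  simp
  ring

open Polynomial in
theorem natDegree_taylor_sub_self_le {f : Polynomial ℝ} {d : ℕ} (hf : f.natDegree ≤ d + 1) (h : ℝ) :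
    (taylor h f - f).natDegree ≤ d := by
  rw [natDegree_le_iff_coeff_eq_zero]
  intro n hn
  have h1 : (hasseDeriv n f).natDegree < 1 := by
    have := natDegree_hasseDeriv_le f n
    omega
  rw [coeff_sub, taylor_coeff, eval_eq_sum_range' h1]
  simp [hasseDeriv_coeff]

/-- A polynomial of degree at most `d` that is within `ε` of an integer on a proportion `1 / K` of
`[-N, N]` has coefficients close to rationals of height at most `K ^ C`. -/
def PolyRecurrence (d C : ℕ) : Prop :=
  ∀ (K N ε : ℝ) (A : Finset ℤ) (f : Polynomial ℝ), 2 ≤ K → K ^ C ≤ N → 0 ≤ ε → ε * K ^ C ≤ 1 →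
    f.natDegree ≤ d → (∀ n ∈ A, |(n : ℝ)| ≤ N) → N ≤ K * A.card →
    (∀ n ∈ A, torusNorm (f.eval (n : ℝ)) ≤ ε) →
    ∃ Q : ℕ, 1 ≤ Q ∧ (Q : ℝ) ≤ K ^ C ∧ ∀ j, torusNorm (Q * f.coeff j) ≤ ε * K ^ C / N ^ j

theorem polyRecurrence_zero : PolyRecurrence 0 0 := by
  intro K N ε A f hK hN hε _ hf _ hcard hA
  rw [pow_zero] at hN
  have hne : A.Nonempty := by
    rw [nonempty_iff_ne_empty]
    rintro rfl
    simp at hcard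
    linarith
  obtain ⟨n, hn⟩ := hne
  refine ⟨1, le_rfl, by simp, fun j => ?_⟩
  rw [Polynomial.eq_C_of_natDegree_le_zero hf] at hA ⊢
  have := hA n hn
  rw [Polynomial.eval_C] at this
  rw [Polynomial.coeff_C]
  split_ifs with hj
  · simpa [hj] using this
  · simp [torusNorm_zero]
    positivity

theorem exists_popular_differences {K N : ℝ} (hK : 2 ≤ K) (hN : 1 ≤ N) (A : Finset ℤ)
    (hA : ∀ n ∈ A, |(n : ℝ)| ≤ N) (hcard : N ≤ K * A.card) :
    ∃ G : Finset ℤ, (∀ h ∈ G, |(h : ℝ)| ≤ 2 * N) ∧ N ≤ K ^ 5 * G.card ∧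
      ∀ h ∈ G, N ≤ K ^ 6 * (A.filter (fun n => n + h ∈ A)).card := by
  have hK0 : 0 < K := by linarith
  have h1 := sum_sum_eq_sum_shift A hA (fun _ _ => (1 : ℝ))
  simp only [sum_const, nsmul_eq_mul, mul_one] at h1
  have h2 := card_popular_shift hK hN (fun h => ((A.filter (fun n => n + h ∈ A)).card : ℝ))
    (fun h => card_le_three_mul _ hN (fun n hn => hA n (mem_filter.1 hn).1)) (by
      rw [← h1, ← sq, ← div_pow]
      gcongr
      rw [div_le_iff₀ hK0]
      linarith)
  refine ⟨_, ?_, h2, ?_⟩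
  · intro h hh
    rw [mem_filter, mem_Icc, Int.ceil_le, Int.le_floor] at hh
    exact abs_le.2 ⟨by linarith, hh.1.2⟩
  · intro h hh
    have := (mem_filter.1 hh).2
    rw [div_le_iff₀ (by positivity)] at this
    linarith

/-- If f is almost integral at n and n + h, so is f(n+h) - f(n), whose coefficient of degree d is
h(d+1) times the top coefficient of f. Induction for many h, one common Q, and Vinogradov's lemma in
h gain the last factor 1/N. -/
theorem top_coeff_recurrence {d C : ℕ} (ih : PolyRecurrence d C) :
    ∃ E : ℕ, ∀ (K N ε : ℝ) (A : Finset ℤ) (f : Polynomial ℝ), 2 ≤ K → K ^ E ≤ N → 0 ≤ ε →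
      ε * K ^ E ≤ 1 →
      f.natDegree ≤ d + 1 → (∀ n ∈ A, |(n : ℝ)| ≤ N) → N ≤ K * A.card →
      (∀ n ∈ A, torusNorm (f.eval (n : ℝ)) ≤ ε) →
      ∃ Q : ℕ, 1 ≤ Q ∧ (Q : ℝ) ≤ K ^ E ∧
        torusNorm (Q * f.coeff (d + 1)) ≤ ε * K ^ E / N ^ (d + 1) := by
  -- The 1 absorbs a factor 2, 6C is induction at K^6, (6+6C)·20 is Vinogradov's lemma at K^(6+6C),
  -- and d+1 pays for the factor d+1 in the denominator.
  refine ⟨1 + 6 * C + (6 + 6 * C) * 20 + (d + 1), ?_⟩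
  set E := 1 + 6 * C + (6 + 6 * C) * 20 + (d + 1) with hE
  intro K N ε A f hK hN hε hεK hf hA hcard hT
  have hK0 : 0 < K := by linarith
  have hK1 : 1 ≤ K := by linarith
  have hN1 : 1 ≤ N := (one_le_pow₀ hK1).trans hN
  have hN0 : 0 < N := by linarith
  obtain ⟨G, hG, hGcard, hGA⟩ := exists_popular_differences hK hN1 A hA hcard
  have hGne : G.Nonempty := by
    rw [nonempty_iff_ne_empty]
    rintro rfl
    simp at hGcard
    linarith
  have hmono : ∀ a ≤ E, K ^ a ≤ K ^ E := fun a ha => pow_le_pow_right₀ hK1 ha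
  have hstep : ∀ h ∈ G, ∃ Q : ℕ, 1 ≤ Q ∧ (Q : ℝ) ≤ (K ^ 6) ^ C ∧
      torusNorm (h * (Q * ((d + 1) * f.coeff (d + 1)))) ≤ 2 * ε * (K ^ 6) ^ C / N ^ d := by
    intro h hh
    obtain ⟨Q, hQ1, hQ2, hQ3⟩ := ih (K ^ 6) N (2 * ε) (A.filter (fun n => n + h ∈ A))
      (Polynomial.taylor (h : ℝ) f - f) (by nlinarith [one_le_pow₀ hK1 (n := 5), pow_succ K 5])
      (by rw [← pow_mul]; exact (hmono _ (by omega)).trans hN) (by positivity)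
      (by
        rw [← pow_mul]
        calc 2 * ε * K ^ (6 * C) ≤ K * ε * K ^ (6 * C) := by gcongr
          _ = ε * K ^ (1 + 6 * C) := by ring
          _ ≤ ε * K ^ E := by gcongr; omega
          _ ≤ 1 := hεK)
      (natDegree_taylor_sub_self_le hf _) (fun n hn => hA n (mem_filter.1 hn).1) (hGA h hh)
      (by
        intro n hn
        rw [mem_filter] at hn
        rw [Polynomial.eval_sub, Polynomial.taylor_eval]
        have h1 := hT n hn.1
        have h2 := hT (n + h) hn.2
        push_cast at h2
        linarith [torusNorm_sub_le (f.eval ((n : ℝ) + h)) (f.eval (n : ℝ))])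
    refine ⟨Q, hQ1, hQ2, ?_⟩
    have := hQ3 d
    rw [taylor_sub_self_coeff hf] at this
    rwa [mul_left_comm] at this
  obtain ⟨Q, hQ1, hQ2, G', hG', hGG', hQ3⟩ := exists_common_denominator G hGne _ hstep
  obtain ⟨Q2, hQ21, hQ22, hQ23⟩ := linear_recurrence (K := K ^ (6 + 6 * C)) (N := 2 * N)
    (ε := 2 * ε * (K ^ 6) ^ C / N ^ d) (α := Q * ((d + 1) * f.coeff (d + 1)))
    (by
      calc 2 ≤ K ^ 1 := by simpa using hK
        _ ≤ _ := pow_le_pow_right₀ hK1 (by omega))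
    (by
      rw [← pow_mul]
      linarith [hmono ((6 + 6 * C) * 20) (by omega)])
    (by
      rw [← pow_mul, ← pow_mul, div_mul_eq_mul_div, div_le_one (by positivity)]
      calc 2 * ε * K ^ (6 * C) * K ^ ((6 + 6 * C) * 20)
          ≤ K * ε * K ^ (6 * C) * K ^ ((6 + 6 * C) * 20) := by gcongr
        _ = ε * K ^ (1 + 6 * C + (6 + 6 * C) * 20) := by ring
        _ ≤ ε * K ^ E := by gcongr; omega
        _ ≤ 1 := hεK
        _ ≤ N ^ d := one_le_pow₀ hN1)
    (by positivity) G' (fun h hh => hG h (hG' hh))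
    (by
      calc 2 * N ≤ K * (K ^ 5 * ((K ^ 6) ^ C * G'.card)) := by gcongr; exact hGcard.trans (by gcongr)
        _ = K ^ (6 + 6 * C) * G'.card := by ring)
    hQ3
  refine ⟨Q2 * Q * (d + 1), ?_, ?_, ?_⟩
  · exact Nat.mul_pos (Nat.mul_pos hQ21 hQ1) (by omega)
  · push_cast
    calc (Q2 : ℝ) * Q * (d + 1) ≤ (K ^ (6 + 6 * C)) ^ 20 * (K ^ 6) ^ C * K ^ (d + 1) := by
          gcongr
          exact_mod_cast natCast_le_pow hK (d + 1)
      _ = K ^ ((6 + 6 * C) * 20 + 6 * C + (d + 1)) := by ring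
      _ ≤ K ^ E := hmono _ (by omega)
  · have h1 : ((Q2 * Q * (d + 1) : ℕ) : ℝ) * f.coeff (d + 1) =
        Q2 * (Q * ((d + 1) * f.coeff (d + 1))) := by push_cast; ring
    rw [h1]
    refine hQ23.trans ?_
    rw [div_mul_eq_mul_div, div_div]
    calc 2 * ε * (K ^ 6) ^ C * (K ^ (6 + 6 * C)) ^ 20 / (N ^ d * (2 * N))
        = ε * K ^ (6 * C + (6 + 6 * C) * 20) / N ^ (d + 1) := by
          rw [← pow_mul, ← pow_mul, pow_add, pow_succ]
          field_simp
      _ ≤ ε * K ^ E / N ^ (d + 1) := by gcongr; omega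

/-- After scaling by Q, the top monomial is nearly integral on all of [-N, N]: |n|^(d+1) ≤ N^(d+1)
cancels the gain in its coefficient. Removing it lowers the degree. -/
theorem polyRecurrence_succ {d C : ℕ} (ih : PolyRecurrence d C) :
    ∃ C', PolyRecurrence (d + 1) C' := by
  obtain ⟨E, hE⟩ := top_coeff_recurrence ih
  refine ⟨1 + E + C, ?_⟩
  intro K N ε A f hK hN hε hεK hf hA hcard hT
  have hK0 : 0 < K := by linarith
  have hK1 : 1 ≤ K := by linarith
  have hN1 : 1 ≤ N := (one_le_pow₀ hK1).trans hN
  have hN0 : 0 < N := by linarith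
  have hmono : ∀ a ≤ 1 + E + C, K ^ a ≤ K ^ (1 + E + C) := fun a ha => pow_le_pow_right₀ hK1 ha
  obtain ⟨Q, hQ1, hQ2, hQ3⟩ := hE K N ε A f hK ((hmono _ (by omega)).trans hN) hε
    (le_trans (by gcongr; omega) hεK) hf hA hcard hT
  set g : Polynomial ℝ :=
    Polynomial.C (Q : ℝ) * (f - Polynomial.monomial (d + 1) (f.coeff (d + 1))) with hg
  have hgcoeff : ∀ j, g.coeff j = if j = d + 1 then 0 else Q * f.coeff j := by
    intro j
    rw [hg, Polynomial.coeff_C_mul, Polynomial.coeff_sub, Polynomial.coeff_monomial]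
    by_cases h : j = d + 1
    · simp [h]
    · rw [if_neg (Ne.symm h), if_neg h, sub_zero]
  have hgdeg : g.natDegree ≤ d := by
    rw [Polynomial.natDegree_le_iff_coeff_eq_zero]
    intro j hj
    rw [hgcoeff]
    split_ifs with h
    · rfl
    · rw [Polynomial.coeff_eq_zero_of_natDegree_lt (by omega), mul_zero]
  obtain ⟨Q2, hQ21, hQ22, hQ23⟩ := ih K N (ε * K ^ (1 + E)) A g hK
    ((hmono _ (by omega)).trans hN) (by positivity) (by rw [mul_assoc, ← pow_add]; exact hεK)
    hgdeg hA hcard (by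
      intro n hn
      have h1 : g.eval (n : ℝ) = Q * f.eval (n : ℝ) -
          ((n ^ (d + 1) : ℤ) : ℝ) * (Q * f.coeff (d + 1)) := by
        rw [hg, Polynomial.eval_mul, Polynomial.eval_C, Polynomial.eval_sub,
          Polynomial.eval_monomial]
        push_cast
        ring
      rw [h1]
      have h2 : torusNorm (Q * f.eval (n : ℝ)) ≤ K ^ E * ε :=
        (torusNorm_nat_mul_le _ _).trans (mul_le_mul hQ2 (hT n hn) (torusNorm_nonneg _) (by positivity))
      have h3 : torusNorm (((n ^ (d + 1) : ℤ) : ℝ) * (Q * f.coeff (d + 1))) ≤ K ^ E * ε := by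
        refine (torusNorm_int_mul_le _ _).trans ?_
        push_cast
        rw [abs_pow]
        calc |(n : ℝ)| ^ (d + 1) * torusNorm (Q * f.coeff (d + 1))
            ≤ N ^ (d + 1) * (ε * K ^ E / N ^ (d + 1)) := by
              gcongr
              · exact torusNorm_nonneg _
              · exact hA n hn
          _ = K ^ E * ε := by field_simp
      calc _ ≤ _ := torusNorm_sub_le _ _
        _ ≤ 2 * (K ^ E * ε) := by linarith
        _ ≤ K * (K ^ E * ε) := by gcongr
        _ = _ := by ring)
  refine ⟨Q2 * Q, Nat.mul_pos hQ21 hQ1, ?_, ?_⟩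
  · push_cast
    calc (Q2 : ℝ) * Q ≤ K ^ C * K ^ E := by gcongr
      _ = K ^ (C + E) := by ring
      _ ≤ _ := hmono _ (by omega)
  · intro j
    by_cases hj : j = d + 1
    · subst hj
      push_cast
      rw [mul_assoc]
      calc _ ≤ _ := torusNorm_nat_mul_le _ _
        _ ≤ K ^ C * (ε * K ^ E / N ^ (d + 1)) := by
          gcongr
          exact torusNorm_nonneg _
        _ = ε * K ^ (E + C) / N ^ (d + 1) := by ring
        _ ≤ _ := by gcongr; omega
    · have := hQ23 j
      rw [hgcoeff, if_neg hj] at this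
      push_cast
      rw [mul_assoc]
      refine this.trans (le_of_eq ?_)
      ring

theorem exists_polyRecurrence (d : ℕ) : ∃ C, PolyRecurrence d C := by
  induction d with
  | zero => exact ⟨0, polyRecurrence_zero⟩
  | succ d ih =>
    obtain ⟨C, hC⟩ := ih
    exact polyRecurrence_succ hC

/-! ### Weyl sums in one variable -/

/-- `S` consists of the members of a residue class modulo `q` that lie in an interval. -/
def IsSegment (q : ℕ) (S : Finset ℤ) : Prop :=
  ∃ a b r : ℤ, S = (Icc a b).filter (fun n => (q : ℤ) ∣ n - r)

/-- Segments survive differencing: the intersection of S with its translate is a shorter segment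
when q divides h, and empty otherwise. -/
theorem IsSegment.filter_shift {q : ℕ} {S : Finset ℤ} (hS : IsSegment q S) (h : ℤ) :
    IsSegment q (S.filter (fun n => n + h ∈ S)) := by
  obtain ⟨a, b, r, rfl⟩ := hS
  by_cases hq : (q : ℤ) ∣ h
  · refine ⟨max a (a - h), min b (b - h), r, ?_⟩
    ext n
    simp only [mem_filter, mem_Icc, max_le_iff, le_min_iff]
    constructor
    · rintro ⟨⟨⟨h1, h2⟩, h3⟩, ⟨h4, h5⟩, _⟩
      exact ⟨⟨⟨h1, by linarith⟩, h2, by linarith⟩, h3⟩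
    · rintro ⟨⟨⟨h1, h2⟩, h3, h4⟩, h5⟩
      refine ⟨⟨⟨h1, h3⟩, h5⟩, ⟨by linarith, by linarith⟩, ?_⟩
      rw [show n + h - r = (n - r) + h by ring]
      exact dvd_add h5 hq
  · refine ⟨1, 0, 0, ?_⟩
    ext n
    simp only [mem_filter, mem_Icc]
    constructor
    · rintro ⟨⟨_, h3⟩, _, h6⟩
      exfalso
      apply hq
      have := dvd_sub h6 h3
      rwa [show n + h - r - (n - r) = h by ring] at this
    · rintro ⟨⟨h1, h2⟩, _⟩
      omega

/-! ### Averaging over short progressions and the linear coefficient -/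

theorem IsSegment.exists_filter_eq_Ico {q : ℕ} {S : Finset ℤ} (hS : IsSegment q S) {s : ℕ}
    (hqs : q ∣ s) (n : ℤ) (M : ℕ) :
    ∃ m₀ L : ℕ, L ≤ M ∧ (range M).filter (fun m : ℕ => n + s * m ∈ S) = Ico m₀ (m₀ + L) := by
  obtain ⟨a, b, r, rfl⟩ := hS
  set X := (range M).filter
    (fun m : ℕ => n + s * m ∈ (Icc a b).filter (fun n => (q : ℤ) ∣ n - r)) with hX
  rcases X.eq_empty_or_nonempty with h | hne
  · exact ⟨0, 0, Nat.zero_le _, by simpa using h⟩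
  · have hmin := X.min'_mem hne
    have hmax := X.max'_mem hne
    have hle := X.min'_le _ hmax
    refine ⟨X.min' hne, X.max' hne + 1 - X.min' hne, ?_, ?_⟩
    · have := mem_range.1 (mem_filter.1 hmax).1
      omega
    · ext m
      rw [mem_Ico]
      constructor
      · intro hm
        have h1 := X.min'_le _ hm
        have h2 := X.le_max' _ hm
        omega
      · rintro ⟨h1, h2⟩
        have h2 : m ≤ X.max' hne := by omega
        have hmem : ∀ m, m ∈ X ↔ m < M ∧ (a ≤ n + s * m ∧ n + s * m ≤ b) ∧ (q : ℤ) ∣ n + s * m - r := by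
          intro m
          simp only [hX, mem_filter, mem_range, mem_Icc]
        rw [hmem] at hmin hmax ⊢
        have h3 : (s : ℤ) * (X.min' hne : ℕ) ≤ s * m := by gcongr
        have h4 : (s : ℤ) * m ≤ s * (X.max' hne : ℕ) := by gcongr
        refine ⟨by omega, ⟨hmin.2.1.1.trans (by gcongr), le_trans (by gcongr) hmax.2.1.2⟩, ?_⟩
        have h5 : (q : ℤ) ∣ s := by exact_mod_cast hqs
        rw [show n + s * m - r =
          (n + s * (X.min' hne : ℕ) - r) + s * (m - (X.min' hne : ℕ)) by ring]
        exact dvd_add hmin.2.2 (h5.mul_right _)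

/-- Average the sum over its translates by sm with m < M. The base points n stay in [-2N, 2N], so
there are at most 5N of them and the best one is at least the average. -/
theorem exists_shift_average (S : Finset ℤ) {N : ℝ} (hN : 1 ≤ N) (hS : ∀ n ∈ S, |(n : ℝ)| ≤ N)
    (F : ℤ → ℂ) (s M : ℕ) (hsM : (s : ℝ) * M ≤ N) :
    ∃ n : ℤ, M * ‖∑ x ∈ S, F x‖ ≤
      5 * N * ‖∑ m ∈ (range M).filter (fun m : ℕ => n + s * m ∈ S), F (n + s * m)‖ := by
  set B := Icc ⌈-(2 * N)⌉ ⌊2 * N⌋ with hB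
  have hBcard : (B.card : ℝ) ≤ 5 * N :=
    (card_Icc_ceil_floor_le (by linarith)).trans (by linarith)
  have hBne : B.Nonempty := ⟨0, by
    rw [hB, mem_Icc, Int.ceil_le, Int.le_floor]
    constructor <;> push_cast <;> linarith⟩
  have hshift : ∀ m ∈ range M, ∑ x ∈ S, F x =
      ∑ n ∈ B, if n + s * (m : ℤ) ∈ S then F (n + s * m) else 0 := by
    intro m hm
    rw [← sum_filter]
    refine sum_nbij' (fun x => x - s * m) (fun n => n + s * m) ?_ ?_ ?_ ?_ ?_
    · intro x hx
      have h1 := abs_le.1 (hS x hx)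
      have h2 : (s : ℝ) * m ≤ N := by
        refine le_trans ?_ hsM
        gcongr
        exact (mem_range.1 hm).le
      have h3 : 0 ≤ (s : ℝ) * m := by positivity
      rw [mem_filter, hB, mem_Icc, Int.ceil_le, Int.le_floor]
      push_cast
      exact ⟨⟨by linarith, by linarith⟩, by simpa using hx⟩
    · intro n hn
      exact (mem_filter.1 hn).2
    · intro x _; ring
    · intro n _; ring
    · intro x _; simp
  have htot : (M : ℂ) * ∑ x ∈ S, F x =
      ∑ n ∈ B, ∑ m ∈ (range M).filter (fun m : ℕ => n + s * m ∈ S), F (n + s * m) := by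
    have : (M : ℂ) * ∑ x ∈ S, F x = ∑ m ∈ range M, ∑ x ∈ S, F x := by
      rw [sum_const, card_range, nsmul_eq_mul]
    rw [this, sum_congr rfl hshift, sum_comm]
    refine sum_congr rfl fun n _ => ?_
    rw [sum_filter]
  obtain ⟨n, _, hn⟩ := exists_max_image B
    (fun n => ‖∑ m ∈ (range M).filter (fun m : ℕ => n + s * m ∈ S), F (n + s * m)‖) hBne
  refine ⟨n, ?_⟩
  have h1 : (M : ℝ) * ‖∑ x ∈ S, F x‖ = ‖(M : ℂ) * ∑ x ∈ S, F x‖ := by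
    rw [norm_mul, Complex.norm_natCast]
  rw [h1, htot]
  refine (norm_sum_le _ _).trans ((sum_le_card_nsmul _ _ _ hn).trans ?_)
  rw [nsmul_eq_mul]
  gcongr

theorem IsSegment.exists_progression_average {q : ℕ} {S : Finset ℤ} (hq : IsSegment q S) {N : ℝ}
    (hN : 1 ≤ N) (hS : ∀ n ∈ S, |(n : ℝ)| ≤ N)
    (F : ℤ → ℂ) {s : ℕ} (hqs : q ∣ s) (M : ℕ) (hsM : (s : ℝ) * M ≤ N) :
    ∃ (n : ℤ) (L : ℕ), L ≤ M ∧ (∀ k < L, n + s * (k : ℤ) ∈ S) ∧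
      M * ‖∑ x ∈ S, F x‖ ≤ 5 * N * ‖∑ k ∈ range L, F (n + s * k)‖ := by
  obtain ⟨n, hn⟩ := exists_shift_average S hN hS F s M hsM
  obtain ⟨m₀, L, hL, hX⟩ := hq.exists_filter_eq_Ico hqs n M
  refine ⟨n + s * m₀, L, hL, ?_, ?_⟩
  · intro k hk
    have : m₀ + k ∈ (range M).filter (fun m : ℕ => n + s * m ∈ S) := by
      rw [hX, mem_Ico]; omega
    have := (mem_filter.1 this).2
    push_cast at this
    rwa [mul_add, ← add_assoc] at this
  · rw [hX, sum_Ico_eq_sum_range, Nat.add_sub_cancel_left] at hn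
    have hF : ∀ k : ℕ, F (n + s * m₀ + s * k) = F (n + s * (m₀ + k : ℕ)) := by
      intro k
      congr 1
      push_cast
      ring
    simp_rw [hF]
    exact hn

theorem exists_pow_sub_pow_eq {N : ℝ} {x y : ℤ} (hx : |(x : ℝ)| ≤ N)
    (hy : |(y : ℝ)| ≤ N) (j : ℕ) :
    ∃ w : ℤ, (x : ℝ) ^ j - (y : ℝ) ^ j = (x - y) * w ∧ |(w : ℝ)| ≤ j * N ^ (j - 1) := by
  refine ⟨∑ i ∈ range j, x ^ i * y ^ (j - 1 - i), ?_, ?_⟩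
  · push_cast
    rw [mul_comm, geom_sum₂_mul]
  · push_cast
    refine (abs_sum_le_sum_abs _ _).trans ?_
    have : ∀ i ∈ range j, |(x : ℝ) ^ i * (y : ℝ) ^ (j - 1 - i)| ≤ N ^ (j - 1) := by
      intro i hi
      have hN : 0 ≤ N := (abs_nonneg _).trans hx
      have hi := mem_range.1 hi
      rw [abs_mul, abs_pow, abs_pow]
      calc |(x : ℝ)| ^ i * |(y : ℝ)| ^ (j - 1 - i) ≤ N ^ i * N ^ (j - 1 - i) := by gcongr
        _ = N ^ (j - 1) := by rw [← pow_add]; congr 1; omega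
    refine (sum_le_card_nsmul _ _ _ this).trans ?_
    rw [card_range, nsmul_eq_mul]

/-- For j ≥ 2, x^j - n^j is qQk times an integer of size at most jN^(j-1). Attaching Q to the
coefficient leaves an integer multiple of an almost integral number, so only the linear term
matters. -/
theorem torusNorm_eval_sub_linear_le {d : ℕ} {f : Polynomial ℝ} (hf : f.natDegree ≤ d) {N B : ℝ}
    (hN : 0 < N) {q Q : ℕ} (hQ : ∀ j, 2 ≤ j → torusNorm (Q * f.coeff j) ≤ B / N ^ j)
    {n : ℤ} {k : ℕ} (hn : |(n : ℝ)| ≤ N) (hnk : |((n + (q * Q : ℕ) * k : ℤ) : ℝ)| ≤ N) :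
    torusNorm (f.eval ((n + (q * Q : ℕ) * k : ℤ) : ℝ) -
      (f.eval (n : ℝ) + k * ((q * Q : ℕ) * f.coeff 1))) ≤ (d + 2) ^ 2 * (q * k * B / N) := by
  have hB : 0 ≤ B / N := by
    have h1 : 0 ≤ B / N ^ 2 := (torusNorm_nonneg _).trans (hQ 2 le_rfl)
    have h2 : B / N = B / N ^ 2 * N := by field_simp
    rw [h2]
    positivity
  set x : ℤ := n + (q * Q : ℕ) * k with hx
  have hxn : (x : ℝ) - n = (q * Q : ℕ) * k := by rw [hx]; push_cast; ring
  -- The range d + 2 contains the index 1 even when d = 0.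
  have hd : f.natDegree < d + 2 := by omega
  have hsum : f.eval (x : ℝ) - (f.eval (n : ℝ) + k * ((q * Q : ℕ) * f.coeff 1)) =
      ∑ j ∈ range (d + 2), (f.coeff j * ((x : ℝ) ^ j - (n : ℝ) ^ j) -
        if j = 1 then k * ((q * Q : ℕ) * f.coeff 1) else 0) := by
    rw [sum_sub_distrib, sum_ite_eq' (range (d + 2)) 1, if_pos (mem_range.2 (by omega)),
      Polynomial.eval_eq_sum_range' hd, Polynomial.eval_eq_sum_range' hd]
    simp_rw [mul_sub]
    rw [sum_sub_distrib]
    ring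
  rw [hsum]
  refine (torusNorm_sum_le _ _).trans ?_
  have hterm : ∀ j ∈ range (d + 2), torusNorm (f.coeff j * ((x : ℝ) ^ j - (n : ℝ) ^ j) -
        if j = 1 then k * ((q * Q : ℕ) * f.coeff 1) else 0) ≤ (d + 2) * (q * k * B / N) := by
    intro j hj
    have hrhs : 0 ≤ ((d : ℝ) + 2) * (q * k * B / N) := by
      rw [mul_div_assoc]
      positivity
    have hj := mem_range.1 hj
    obtain rfl | rfl | hj2 : j = 0 ∨ j = 1 ∨ 2 ≤ j := by omega
    · simpa [torusNorm_zero] using hrhs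
    · rw [if_pos rfl, pow_one, pow_one, hxn]
      rw [show f.coeff 1 * (((q * Q : ℕ) : ℝ) * k) - k * ((q * Q : ℕ) * f.coeff 1) = 0 by ring,
        torusNorm_zero]
      exact hrhs
    · rw [if_neg (by omega), sub_zero]
      obtain ⟨w, hw1, hw2⟩ := exists_pow_sub_pow_eq hnk hn j
      rw [hw1, hxn]
      have h1 : f.coeff j * (((q * Q : ℕ) : ℝ) * k * w) =
          ((q * k * w : ℤ) : ℝ) * (Q * f.coeff j) := by push_cast; ring
      rw [h1]
      refine (torusNorm_int_mul_le _ _).trans ?_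
      push_cast
      rw [abs_mul, abs_mul, Nat.abs_cast, Nat.abs_cast]
      have hjd : (j : ℝ) ≤ d + 2 := by exact_mod_cast hj.le
      calc (q : ℝ) * k * |(w : ℝ)| * torusNorm (Q * f.coeff j)
          ≤ q * k * (j * N ^ (j - 1)) * (B / N ^ j) := by
            gcongr
            · exact torusNorm_nonneg _
            · exact hQ j hj2
        _ = j * (q * k * B / N) := by
            obtain ⟨i, rfl⟩ : ∃ i, j = i + 1 := ⟨j - 1, by omega⟩
            rw [Nat.add_sub_cancel, pow_succ]
            field_simp
        _ ≤ (d + 2) * (q * k * B / N) := by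
            rw [mul_div_assoc]
            gcongr
  refine (sum_le_card_nsmul _ _ _ hterm).trans (le_of_eq ?_)
  rw [card_range, nsmul_eq_mul]
  push_cast
  ring

/-- On a progression of step qQ and length about N/K^c the phase is nearly linear with slope θ =
qQ·f₁. Its geometric sum is large, so θ is within K^O(1)/N of an integer. -/
theorem linear_coeff_of_large_sum (d c₀ : ℕ) :
    ∃ E : ℕ, ∀ (K N : ℝ) (q Q : ℕ) (S : Finset ℤ) (f : Polynomial ℝ), 2 ≤ K → K ^ E ≤ N →
      1 ≤ q → (q : ℝ) ≤ K → 1 ≤ Q → (Q : ℝ) ≤ K ^ c₀ → IsSegment q S →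
      (∀ n ∈ S, |(n : ℝ)| ≤ N) → f.natDegree ≤ d →
      (∀ j, 2 ≤ j → torusNorm (Q * f.coeff j) ≤ K ^ c₀ / N ^ j) →
      N ≤ K * ‖∑ n ∈ S, e (f.eval (n : ℝ))‖ →
      torusNorm ((q * Q : ℕ) * f.coeff 1) ≤ K ^ E / N := by
  -- The part 1 + c₀ pays for qQ, (d+2)^2 for the constant in the linear approximation, and 7 leaves
  -- an error of order K^(-7) per term.
  obtain ⟨c, hc⟩ : ∃ c, c = 1 + c₀ + (d + 2) ^ 2 + 7 := ⟨_, rfl⟩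
  refine ⟨6 + c, ?_⟩
  intro K N q Q S f hK hN hq1 hqK hQ1 hQK hseg hS hf hcoef hsum
  have hK0 : 0 < K := by linarith
  have hK1 : 1 ≤ K := by linarith
  have hN1 : 1 ≤ N := (one_le_pow₀ hK1).trans hN
  have hN0 : 0 < N := by linarith
  have hK6 : 64 ≤ K ^ 6 := by
    calc (64 : ℝ) = 2 ^ 6 := by norm_num
      _ ≤ K ^ 6 := by gcongr
  have hKc : 0 < K ^ c := by positivity
  have hNc : 64 ≤ N / K ^ c := by
    rw [le_div_iff₀ hKc]
    refine le_trans ?_ hN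
    rw [pow_add]
    exact mul_le_mul_of_nonneg_right hK6 hKc.le
  set M := ⌊N / K ^ c⌋₊ with hM
  have hM1 : (M : ℝ) ≤ N / K ^ c := Nat.floor_le (by positivity)
  have hM2 : N / K ^ c ≤ 2 * M := by
    have := Nat.lt_floor_add_one (N / K ^ c)
    rw [← hM] at this
    linarith
  have hM0 : (0 : ℝ) < M := by linarith
  have hsM : ((q * Q : ℕ) : ℝ) * M ≤ N := by
    push_cast
    calc (q : ℝ) * Q * M ≤ K * K ^ c₀ * (N / K ^ c) := by gcongr
      _ = K ^ (1 + c₀) / K ^ c * N := by ring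
      _ ≤ 1 * N := by
        gcongr
        rw [div_le_one hKc]
        exact pow_le_pow_right₀ hK1 (by omega)
      _ = N := one_mul _
  obtain ⟨n, L, hLM, hL, hbig⟩ := hseg.exists_progression_average hN1 hS
    (fun x => e (f.eval (x : ℝ))) (Dvd.intro Q rfl : q ∣ q * Q) M hsM
  have hML : (M : ℝ) ≤ 5 * K * ‖∑ k ∈ range L, e (f.eval ((n + (q * Q : ℕ) * k : ℤ) : ℝ))‖ := by
    have h1 : M * N ≤ (5 * K * ‖∑ k ∈ range L, e (f.eval ((n + (q * Q : ℕ) * k : ℤ) : ℝ))‖) * N := by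
      calc M * N ≤ M * (K * ‖∑ n ∈ S, e (f.eval (n : ℝ))‖) := by gcongr
        _ = K * (M * ‖∑ n ∈ S, e (f.eval (n : ℝ))‖) := by ring
        _ ≤ K * _ := mul_le_mul_of_nonneg_left hbig hK0.le
        _ = _ := by ring
    exact le_of_mul_le_mul_right h1 hN0
  set θ := ((q * Q : ℕ) : ℝ) * f.coeff 1 with hθ
  have hη : ∀ k ∈ range L, ‖e (f.eval ((n + (q * Q : ℕ) * k : ℤ) : ℝ)) -
      e (f.eval (n : ℝ) + k * θ)‖ ≤ 8 / K ^ 7 := by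
    intro k hk
    have hk := mem_range.1 hk
    refine (norm_e_sub_e_le _ _).trans ?_
    have hn0 : n ∈ S := by simpa using hL 0 (by omega)
    have h1 := torusNorm_eval_sub_linear_le hf hN0 (q := q) (Q := Q) (B := K ^ c₀) hcoef
      (n := n) (k := k) (hS n hn0) (hS _ (hL k hk))
    have hkM : (k : ℝ) ≤ M := by exact_mod_cast (hk.le.trans hLM)
    have h2 : ((d : ℝ) + 2) ^ 2 * (q * k * K ^ c₀ / N) ≤ 1 / K ^ 7 := by
      have h3 : ((d : ℝ) + 2) ^ 2 ≤ K ^ ((d + 2) ^ 2) := by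
        have := natCast_le_pow hK ((d + 2) ^ 2)
        push_cast at this
        exact this
      calc ((d : ℝ) + 2) ^ 2 * (q * k * K ^ c₀ / N)
          ≤ K ^ ((d + 2) ^ 2) * (K * (N / K ^ c) * K ^ c₀ / N) := by
            gcongr
            exact hkM.trans hM1
        _ = 1 / K ^ 7 := by
          rw [hc, pow_add, pow_add, pow_add]
          field_simp
    calc _ ≤ 8 * (1 / K ^ 7) := by gcongr; exact h1.trans h2
      _ = 8 / K ^ 7 := by ring
  have hlin : ‖∑ k ∈ range L, e (f.eval (n : ℝ) + k * θ)‖ = ‖∑ k ∈ range L, e (k * θ)‖ := by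
    simp_rw [e_add]
    rw [← mul_sum, norm_mul, norm_e, one_mul]
  have hcmp : ‖∑ k ∈ range L, e (f.eval ((n + (q * Q : ℕ) * k : ℤ) : ℝ))‖ ≤
      ‖∑ k ∈ range L, e (k * θ)‖ + M * (8 / K ^ 7) := by
    rw [← hlin]
    have h1 : ‖∑ k ∈ range L, e (f.eval ((n + (q * Q : ℕ) * k : ℤ) : ℝ)) -
        ∑ k ∈ range L, e (f.eval (n : ℝ) + k * θ)‖ ≤ M * (8 / K ^ 7) := by
      rw [← sum_sub_distrib]
      refine (norm_sum_le _ _).trans ((sum_le_card_nsmul _ _ _ hη).trans ?_)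
      rw [card_range, nsmul_eq_mul]
      gcongr
    have h2 := norm_sub_norm_le (∑ k ∈ range L, e (f.eval ((n + (q * Q : ℕ) * k : ℤ) : ℝ)))
      (∑ k ∈ range L, e (f.eval (n : ℝ) + k * θ))
    linarith
  have h40 : 5 * K * ((M : ℝ) * (8 / K ^ 7)) ≤ 5 / 8 * M := by
    calc 5 * K * ((M : ℝ) * (8 / K ^ 7)) = (M : ℝ) * (40 / K ^ 6) := by field_simp; norm_num
      _ ≤ (M : ℝ) * (40 / 64) := by gcongr
      _ = _ := by ring
  have hG : M ≤ 40 / 3 * K * ‖∑ k ∈ range L, e (k * θ)‖ := by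
    have : (M : ℝ) ≤ 5 * K * (‖∑ k ∈ range L, e (k * θ)‖ + M * (8 / K ^ 7)) :=
      hML.trans (by gcongr)
    linarith
  have hT : M * torusNorm θ ≤ 40 / 3 * K := by
    have h1 := norm_geom_sum_e_mul_torusNorm_le θ L
    calc M * torusNorm θ ≤ (40 / 3 * K * ‖∑ k ∈ range L, e (k * θ)‖) * torusNorm θ := by
          gcongr
          exact torusNorm_nonneg _
      _ = 40 / 3 * K * (‖∑ k ∈ range L, e (k * θ)‖ * torusNorm θ) := by ring
      _ ≤ 40 / 3 * K * 1 := by gcongr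
      _ = _ := by ring
  rw [le_div_iff₀ hN0]
  have h5 : N / K ^ c * torusNorm θ ≤ 80 / 3 * K := by
    have := mul_le_mul_of_nonneg_right hM2 (torusNorm_nonneg θ)
    linarith
  rw [div_mul_eq_mul_div, div_le_iff₀ hKc] at h5
  have h6 : 80 / 3 * K ≤ K ^ 6 := by
    have : (32 : ℝ) ≤ K ^ 5 := by
      calc (32 : ℝ) = 2 ^ 5 := by norm_num
        _ ≤ K ^ 5 := by gcongr
    rw [pow_succ]
    gcongr
    linarith
  calc torusNorm θ * N = N * torusNorm θ := mul_comm _ _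
    _ ≤ 80 / 3 * K * K ^ c := h5
    _ ≤ K ^ 6 * K ^ c := by gcongr
    _ = K ^ (6 + c) := (pow_add _ _ _).symm

/-- A polynomial of degree at most `d` with a large exponential sum over a progression of gap at
most `K` has coefficients close to rationals of height at most `K ^ C`. -/
def WeylBound (d C : ℕ) : Prop :=
  ∀ (K N : ℝ) (q : ℕ) (S : Finset ℤ) (f : Polynomial ℝ), 2 ≤ K → K ^ C ≤ N →
    1 ≤ q → (q : ℝ) ≤ K → IsSegment q S → (∀ n ∈ S, |(n : ℝ)| ≤ N) → f.natDegree ≤ d →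
    N ≤ K * ‖∑ n ∈ S, e (f.eval (n : ℝ))‖ →
    ∃ Q : ℕ, 1 ≤ Q ∧ (Q : ℝ) ≤ K ^ C ∧ ∀ j, torusNorm (Q * f.coeff j) ≤ K ^ C / N ^ j

theorem weylBound_zero : WeylBound 0 0 := by
  intro K N q S f hK hN _ _ _ _ hf _
  rw [pow_zero] at hN
  refine ⟨1, le_rfl, by simp, fun j => ?_⟩
  obtain rfl | hj := Nat.eq_zero_or_pos j
  · have := torusNorm_le_half ((1 : ℕ) * f.coeff 0)
    simp only [pow_zero]
    linarith
  · rw [Polynomial.coeff_eq_zero_of_natDegree_lt (by omega), mul_zero, torusNorm_zero]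
    positivity

/-- Weyl differencing: the square of the norm is the sum over h of the correlations, to which the
popularity argument applies. -/
theorem exists_popular_derivatives {K N : ℝ} (hK : 2 ≤ K) (hN : 1 ≤ N) (S : Finset ℤ)
    (hS : ∀ n ∈ S, |(n : ℝ)| ≤ N) (φ : ℤ → ℝ) (hsum : N ≤ K * ‖∑ n ∈ S, e (φ n)‖) :
    ∃ G : Finset ℤ, (∀ h ∈ G, |(h : ℝ)| ≤ 2 * N) ∧ N ≤ K ^ 5 * G.card ∧
      ∀ h ∈ G, N ≤ K ^ 6 * ‖∑ n ∈ S.filter (fun n => n + h ∈ S), e (φ (n + h) - φ n)‖ := by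
  have hK0 : 0 < K := by linarith
  have h1 := sum_sum_eq_sum_shift S hS (fun n m => e (φ m - φ n))
  have h1' : ‖∑ n ∈ S, ∑ m ∈ S, e (φ m - φ n)‖ = ‖∑ n ∈ S, e (φ n)‖ ^ 2 := by
    have : ∑ n ∈ S, ∑ m ∈ S, e (φ m - φ n) =
        (∑ n ∈ S, (starRingEnd ℂ) (e (φ n))) * ∑ m ∈ S, e (φ m) := by
      rw [sum_mul_sum]
      refine sum_congr rfl fun n _ => sum_congr rfl fun m _ => ?_
      rw [e_sub, mul_comm]
    rw [this, ← map_sum, norm_mul, RCLike.norm_conj, sq]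
  have h2 := card_popular_shift hK hN
    (fun h => ‖∑ n ∈ S.filter (fun n => n + h ∈ S), e (φ (n + h) - φ n)‖)
    (fun h => by
      refine (norm_sum_le _ _).trans ?_
      simp only [norm_e, sum_const, nsmul_eq_mul, mul_one]
      exact card_le_three_mul _ hN (fun n hn => hS n (mem_filter.1 hn).1)) (by
      refine le_trans ?_ (norm_sum_le _ _)
      rw [← h1, h1', ← div_pow]
      gcongr
      rw [div_le_iff₀ hK0]
      linarith)
  refine ⟨_, ?_, h2, ?_⟩
  · intro h hh
    rw [mem_filter, mem_Icc, Int.ceil_le, Int.le_floor] at hh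
    exact abs_le.2 ⟨by linarith, hh.1.2⟩
  · intro h hh
    have := (mem_filter.1 hh).2
    rw [div_le_iff₀ (by positivity)] at this
    linarith

/-- Only the linear coefficient f'(h) - f₁ of the differenced phase is used. Recurrence in the
variable h extracts the coefficients of f', and subtracting f₁ is why the bound starts at degree 2.
-/
theorem higher_coeff_of_large_sum {d C R : ℕ} (ih : WeylBound d C) (hR : PolyRecurrence d R) :
    ∃ E : ℕ, ∀ (K N : ℝ) (q : ℕ) (S : Finset ℤ) (f : Polynomial ℝ), 2 ≤ K → K ^ E ≤ N →
      1 ≤ q → (q : ℝ) ≤ K → IsSegment q S → (∀ n ∈ S, |(n : ℝ)| ≤ N) → f.natDegree ≤ d + 1 →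
      N ≤ K * ‖∑ n ∈ S, e (f.eval (n : ℝ))‖ →
      ∃ Q : ℕ, 1 ≤ Q ∧ (Q : ℝ) ≤ K ^ E ∧ ∀ j, 2 ≤ j → torusNorm (Q * f.coeff j) ≤ K ^ E / N ^ j := by
  refine ⟨6 * C + (6 + 6 * C) * R + (d + 1).factorial, ?_⟩
  obtain ⟨E, hE⟩ : ∃ E, E = 6 * C + (6 + 6 * C) * R + (d + 1).factorial := ⟨_, rfl⟩
  rw [← hE]
  intro K N q S f hK hN hq1 hqK hseg hS hf hsum
  have hK0 : 0 < K := by linarith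
  have hK1 : 1 ≤ K := by linarith
  have hN1 : 1 ≤ N := (one_le_pow₀ hK1).trans hN
  have hN0 : 0 < N := by linarith
  have hfac := (d + 1).factorial_pos
  have hmono : ∀ a ≤ E, K ^ a ≤ K ^ E := fun a ha => pow_le_pow_right₀ hK1 ha
  have hK6 : K ≤ K ^ 6 := by
    simpa using pow_le_pow_right₀ hK1 (show 1 ≤ 6 by norm_num)
  obtain ⟨G, hG, hGcard, hGS⟩ := exists_popular_derivatives hK hN1 S hS
    (fun n => f.eval (n : ℝ)) hsum
  have hGne : G.Nonempty := by
    rw [nonempty_iff_ne_empty]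
    rintro rfl
    simp at hGcard
    linarith
  have hstep : ∀ h ∈ G, ∃ Q : ℕ, 1 ≤ Q ∧ (Q : ℝ) ≤ (K ^ 6) ^ C ∧
      torusNorm (Q * (f.derivative.eval (h : ℝ) - f.coeff 1)) ≤ (K ^ 6) ^ C / N := by
    intro h hh
    obtain ⟨Q, hQ1, hQ2, hQ3⟩ := ih (K ^ 6) N q (S.filter (fun n => n + h ∈ S))
      (Polynomial.taylor (h : ℝ) f - f) (hK.trans hK6)
      (by rw [← pow_mul]; exact (hmono _ (by rw [hE, add_assoc]; exact Nat.le_add_right _ _)).trans hN)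
      hq1 (hqK.trans hK6) (hseg.filter_shift h) (fun n hn => hS n (mem_filter.1 hn).1)
      (natDegree_taylor_sub_self_le hf _)
      (by
        refine (hGS h hh).trans (le_of_eq ?_)
        simp only [Polynomial.eval_sub, Polynomial.taylor_eval]
        push_cast
        rfl)
    refine ⟨Q, hQ1, hQ2, ?_⟩
    have := hQ3 1
    rwa [taylor_sub_self_coeff_one, pow_one] at this
  obtain ⟨Q, hQ1, hQ2, G', hG', hGG', hQ3⟩ := exists_common_denominator G hGne _ hstep
  set g : Polynomial ℝ := Polynomial.C (Q : ℝ) * (f.derivative - Polynomial.C (f.coeff 1)) with hg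
  have hgdeg : g.natDegree ≤ d := by
    refine (Polynomial.natDegree_C_mul_le _ _).trans ((Polynomial.natDegree_sub_C).trans_le ?_)
    exact (Polynomial.natDegree_derivative_le f).trans (by omega)
  -- Popularity costs K^5, the common denominator K^(6C), and one more K pays for the doubled
  -- interval.
  obtain ⟨Q2, hQ21, hQ22, hQ23⟩ := hR (K ^ (6 + 6 * C)) (2 * N) ((K ^ 6) ^ C / N) G' g
    (by
      calc 2 ≤ K ^ 1 := by simpa using hK
        _ ≤ _ := pow_le_pow_right₀ hK1 (by omega))
    (by
      rw [← pow_mul]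
      linarith [hmono ((6 + 6 * C) * R) (by omega)])
    (by positivity)
    (by
      rw [← pow_mul, ← pow_mul, div_mul_eq_mul_div, div_le_one hN0, ← pow_add]
      exact (hmono _ (by omega)).trans hN)
    hgdeg (fun h hh => hG h (hG' hh))
    (by
      calc 2 * N ≤ K * (K ^ 5 * ((K ^ 6) ^ C * G'.card)) := by
            gcongr
            exact hGcard.trans (by gcongr)
        _ = K ^ (6 + 6 * C) * G'.card := by ring)
    (by
      intro h hh
      rw [hg, Polynomial.eval_mul, Polynomial.eval_C, Polynomial.eval_sub, Polynomial.eval_C]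
      exact hQ3 h hh)
  have hfacK : ((d + 1).factorial : ℝ) ≤ K ^ (d + 1).factorial := natCast_le_pow hK _
  refine ⟨Q2 * Q * (d + 1).factorial, Nat.mul_pos (Nat.mul_pos hQ21 hQ1) hfac, ?_, ?_⟩
  · push_cast
    calc (Q2 : ℝ) * Q * (d + 1).factorial
        ≤ (K ^ (6 + 6 * C)) ^ R * (K ^ 6) ^ C * K ^ (d + 1).factorial := by gcongr
      _ = K ^ E := by rw [hE]; ring
  · intro j hj
    by_cases hjd : d + 1 < j
    · rw [Polynomial.coeff_eq_zero_of_natDegree_lt (by omega), mul_zero, torusNorm_zero]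
      positivity
    -- The factorial clears the factors j introduced by differentiation, for all degrees at once.
    obtain ⟨t, ht⟩ : j ∣ (d + 1).factorial := Nat.dvd_factorial (by omega) (by omega)
    obtain ⟨i, rfl⟩ : ∃ i, j = i + 1 := ⟨j - 1, by omega⟩
    have hgi : g.coeff i = Q * (f.coeff (i + 1) * (i + 1)) := by
      rw [hg, Polynomial.coeff_C_mul, Polynomial.coeff_sub, Polynomial.coeff_derivative,
        Polynomial.coeff_C_of_ne_zero (by omega), sub_zero]
    have h1 : ((Q2 * Q * (d + 1).factorial : ℕ) : ℝ) * f.coeff (i + 1) =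
        t * (Q2 * g.coeff i) := by
      rw [hgi, ht]
      push_cast
      ring
    have ht1 : (t : ℝ) ≤ K ^ (d + 1).factorial := by
      refine le_trans ?_ hfacK
      rw [ht]
      exact_mod_cast Nat.le_mul_of_pos_left t (by omega)
    rw [h1]
    calc torusNorm (t * (Q2 * g.coeff i)) ≤ t * torusNorm (Q2 * g.coeff i) :=
          torusNorm_nat_mul_le _ _
      _ ≤ K ^ (d + 1).factorial * ((K ^ 6) ^ C / N * (K ^ (6 + 6 * C)) ^ R / (2 * N) ^ i) := by
          gcongr
          · exact torusNorm_nonneg _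
          · exact hQ23 i
      _ ≤ K ^ (d + 1).factorial * ((K ^ 6) ^ C / N * (K ^ (6 + 6 * C)) ^ R / N ^ i) := by
          gcongr
          linarith
      _ = K ^ E / N ^ (i + 1) := by
          rw [hE, ← pow_mul, ← pow_mul, pow_succ N, pow_add, pow_add]
          field_simp

theorem weylBound_succ {d C R : ℕ} (ih : WeylBound d C) (hR : PolyRecurrence d R) :
    ∃ C', WeylBound (d + 1) C' := by
  obtain ⟨E, hE⟩ := higher_coeff_of_large_sum ih hR
  obtain ⟨L, hL⟩ := linear_coeff_of_large_sum (d + 1) E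
  refine ⟨1 + E + L, ?_⟩
  intro K N q S f hK hN hq1 hqK hseg hS hf hsum
  have hK0 : 0 < K := by linarith
  have hK1 : 1 ≤ K := by linarith
  have hN1 : 1 ≤ N := (one_le_pow₀ hK1).trans hN
  have hN0 : 0 < N := by linarith
  have hmono : ∀ a ≤ 1 + E + L, K ^ a ≤ K ^ (1 + E + L) := fun a ha => pow_le_pow_right₀ hK1 ha
  obtain ⟨Q, hQ1, hQ2, hQ3⟩ := hE K N q S f hK ((hmono _ (by omega)).trans hN) hq1 hqK hseg hS hf
    hsum
  have hlin := hL K N q Q S f hK ((hmono _ (by omega)).trans hN) hq1 hqK hQ1 hQ2 hseg hS hf hQ3 hsum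
  refine ⟨q * Q, Nat.mul_pos hq1 hQ1, ?_, ?_⟩
  · push_cast
    calc (q : ℝ) * Q ≤ K * K ^ E := by gcongr
      _ = K ^ (1 + E) := by ring
      _ ≤ _ := hmono _ (by omega)
  · intro j
    obtain rfl | rfl | hj : j = 0 ∨ j = 1 ∨ 2 ≤ j := by omega
    · have h1 := torusNorm_le_half (((q * Q : ℕ) : ℝ) * f.coeff 0)
      have h2 := one_le_pow₀ hK1 (n := 1 + E + L)
      rw [pow_zero, div_one]
      linarith
    · refine hlin.trans ?_
      rw [pow_one]
      gcongr
      omega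
    · push_cast
      rw [mul_assoc]
      calc torusNorm (q * (Q * f.coeff j)) ≤ q * torusNorm (Q * f.coeff j) :=
            torusNorm_nat_mul_le _ _
        _ ≤ K * (K ^ E / N ^ j) := by
            gcongr
            · exact torusNorm_nonneg _
            · exact hQ3 j hj
        _ = K ^ (1 + E) / N ^ j := by ring
        _ ≤ K ^ (1 + E + L) / N ^ j := by
            gcongr ?_ / _
            exact hmono _ (by omega)

theorem exists_weylBound (d : ℕ) : ∃ C, WeylBound d C := by
  induction d with
  | zero => exact ⟨0, weylBound_zero⟩
  | succ d ih =>
    obtain ⟨C, hC⟩ := ih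
    obtain ⟨R, hR⟩ := exists_polyRecurrence d
    exact weylBound_succ hC hR

/-! ### Fibering over the first variable -/

theorem vol_succ {D : ℕ} (N : Fin (D + 1) → ℝ) : vol N = N 0 * vol (Fin.tail N) :=
  Fin.prod_univ_succ _

theorem monom_succ {D : ℕ} (N : Fin (D + 1) → ℝ) (α : Fin (D + 1) →₀ ℕ) :
    monom N α = N 0 ^ α 0 * monom (Fin.tail N) α.tail :=
  Fin.prod_univ_succ _

theorem vol_pos {D : ℕ} {N : Fin D → ℝ} (hN : ∀ i, 1 ≤ N i) : 0 < vol N :=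
  prod_pos fun i _ => by linarith [hN i]

theorem monom_pos {D : ℕ} {N : Fin D → ℝ} (hN : ∀ i, 1 ≤ N i) (α : Fin D →₀ ℕ) : 0 < monom N α :=
  prod_pos fun i _ => pow_pos (by linarith [hN i]) _

theorem card_le_of_mem_box {D : ℕ} {N : Fin D → ℝ} (hN : ∀ i, 1 ≤ N i) (B : Finset (Fin D → ℤ))
    (hB : ∀ n ∈ B, ∀ i, |(n i : ℝ)| ≤ N i) : (B.card : ℝ) ≤ 3 ^ D * vol N := by
  have hsub : B ⊆ Fintype.piFinset fun i => Icc ⌈-N i⌉ ⌊N i⌋ := by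
    intro n hn
    rw [Fintype.mem_piFinset]
    intro i
    have := abs_le.1 (hB n hn i)
    rw [mem_Icc, Int.ceil_le, Int.le_floor]
    exact this
  calc (B.card : ℝ) ≤ ((Fintype.piFinset fun i => Icc ⌈-N i⌉ ⌊N i⌋).card : ℝ) := by
        exact_mod_cast card_le_card hsub
    _ = ∏ i, ((Icc ⌈-N i⌉ ⌊N i⌋).card : ℝ) := by
        rw [Fintype.card_piFinset]; push_cast; rfl
    _ ≤ ∏ i, (3 * N i) := by
        apply prod_le_prod
        · intro i _; positivity
        · intro i _
          exact (card_Icc_ceil_floor_le (by linarith [hN i])).trans (by linarith [hN i])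
    _ = 3 ^ D * vol N := by
        rw [prod_mul_distrib, prod_const, card_univ, Fintype.card_fin]
        rfl

/-- There are at most 3^D·vol ≤ K^(2D)·vol fibers, so those below the threshold carry at most half
of the total weight. -/
theorem exists_good_fibers {D : ℕ} {K : ℝ} (hK : 2 ≤ K) {N : Fin (D + 1) → ℝ}
    (hN : ∀ i, 1 ≤ N i) (B : Finset (Fin D → ℤ)) (hB : ∀ n ∈ B, ∀ i, |(n i : ℝ)| ≤ Fin.tail N i)
    (w : (Fin D → ℤ) → ℝ) (hw : ∀ n ∈ B, w n ≤ 3 * N 0) (hsum : vol N ≤ K * ∑ n ∈ B, w n) :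
    ∃ G ⊆ B, G.Nonempty ∧ vol (Fin.tail N) ≤ K ^ 4 * G.card ∧
      ∀ n ∈ G, N 0 ≤ K ^ (2 + 2 * D) * w n := by
  have hK0 : 0 < K := by linarith
  have hN0 : 0 < N 0 := by linarith [hN 0]
  have hV : 0 < vol (Fin.tail N) := vol_pos fun i => hN i.succ
  have h1 := sum_le_mul_card_filter_add B w (B := 3 * N 0) (τ := N 0 / K ^ (2 + 2 * D))
    (by positivity) hw
  set G := B.filter (fun n => N 0 / K ^ (2 + 2 * D) ≤ w n) with hG
  have h2 : (B.card : ℝ) ≤ K ^ (2 * D) * vol (Fin.tail N) := by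
    refine (card_le_of_mem_box (N := Fin.tail N) (fun i => hN i.succ) B hB).trans ?_
    rw [pow_mul]
    gcongr
    nlinarith
  have h3 : N 0 / K ^ (2 + 2 * D) * B.card ≤ N 0 * vol (Fin.tail N) / K ^ 2 := by
    calc N 0 / K ^ (2 + 2 * D) * B.card
        ≤ N 0 / K ^ (2 + 2 * D) * (K ^ (2 * D) * vol (Fin.tail N)) := by gcongr
      _ = N 0 * vol (Fin.tail N) / K ^ 2 := by
        rw [pow_add]
        field_simp
  have h4 : K * (N 0 * vol (Fin.tail N) / K ^ 2) ≤ N 0 * vol (Fin.tail N) / 2 := by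
    have : K * (N 0 * vol (Fin.tail N) / K ^ 2) = N 0 * vol (Fin.tail N) / K := by
      field_simp
    rw [this]
    gcongr
  have h5 : N 0 * vol (Fin.tail N) ≤ N 0 * (6 * K * G.card) := by
    rw [vol_succ] at hsum
    have h6 : K * ∑ n ∈ B, w n ≤ K * (3 * N 0 * G.card + N 0 * vol (Fin.tail N) / K ^ 2) := by
      gcongr
      linarith
    linarith
  have h7 : vol (Fin.tail N) ≤ 6 * K * G.card := le_of_mul_le_mul_left h5 hN0
  refine ⟨G, filter_subset _ _, ?_, ?_, ?_⟩
  · rw [nonempty_iff_ne_empty]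
    intro h
    rw [h] at h7
    simp at h7
    linarith
  · refine h7.trans ?_
    have : (8 : ℝ) ≤ K ^ 3 := by
      calc (8 : ℝ) = 2 ^ 3 := by norm_num
        _ ≤ K ^ 3 := by gcongr
    rw [pow_succ]
    gcongr
    linarith
  · intro n hn
    have := (mem_filter.1 hn).2
    rw [div_le_iff₀ (by positivity)] at this
    linarith

theorem natDegree_slice_le {D d : ℕ} {P : MvPolynomial (Fin (D + 1)) ℝ} (hP : P.totalDegree ≤ d)
    (x : Fin D → ℝ) :
    (Polynomial.map (MvPolynomial.eval x) (MvPolynomial.finSuccEquiv ℝ D P)).natDegree ≤ d := by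
  refine Polynomial.natDegree_map_le.trans ?_
  rw [MvPolynomial.natDegree_finSuccEquiv]
  exact (MvPolynomial.degreeOf_le_totalDegree _ _).trans hP

theorem totalDegree_coeff_finSuccEquiv_le {D d : ℕ} {P : MvPolynomial (Fin (D + 1)) ℝ}
    (hP : P.totalDegree ≤ d) (j : ℕ) :
    ((MvPolynomial.finSuccEquiv ℝ D P).coeff j).totalDegree ≤ d := by
  by_cases h : (MvPolynomial.finSuccEquiv ℝ D P).coeff j = 0
  · rw [h, MvPolynomial.totalDegree_zero]; exact Nat.zero_le _
  · have := MvPolynomial.totalDegree_coeff_finSuccEquiv_add_le P j h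
    omega

theorem coeff_eq_coeff_finSuccEquiv {D : ℕ} (P : MvPolynomial (Fin (D + 1)) ℝ)
    (α : Fin (D + 1) →₀ ℕ) :
    P.coeff α = ((MvPolynomial.finSuccEquiv ℝ D P).coeff (α 0)).coeff α.tail := by
  rw [MvPolynomial.finSuccEquiv_coeff_coeff, Finsupp.cons_tail]

theorem coeff_finSuccEquiv_eq_zero {D d : ℕ} {P : MvPolynomial (Fin (D + 1)) ℝ}
    (hP : P.totalDegree ≤ d) {j : ℕ} (hj : d < j) :
    (MvPolynomial.finSuccEquiv ℝ D P).coeff j = 0 := by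
  apply Polynomial.coeff_eq_zero_of_natDegree_lt
  rw [MvPolynomial.natDegree_finSuccEquiv]
  exact ((MvPolynomial.degreeOf_le_totalDegree _ _).trans hP).trans_lt hj

theorem eval_cons {D : ℕ} (P : MvPolynomial (Fin (D + 1)) ℝ) (x : ℤ) (n : Fin D → ℤ) :
    MvPolynomial.eval (fun i => ((Fin.cons x n : Fin (D + 1) → ℤ) i : ℝ)) P =
      (Polynomial.map (MvPolynomial.eval (fun i => (n i : ℝ)))
        (MvPolynomial.finSuccEquiv ℝ D P)).eval (x : ℝ) := by
  rw [← MvPolynomial.eval_eq_eval_mv_eval']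
  congr 2
  funext i
  refine Fin.cases ?_ (fun i => ?_) i <;> simp

/-! ### Recurrence of polynomial phases in several variables -/

/-- The analogue of `PolyRecurrence` for polynomials in `D` variables. -/
def MvRecurrence (D d C : ℕ) : Prop :=
  ∀ (K ε : ℝ) (N : Fin D → ℝ) (A : Finset (Fin D → ℤ)) (P : MvPolynomial (Fin D) ℝ), 2 ≤ K →
    (∀ i, K ^ C ≤ N i) → 0 ≤ ε → ε * K ^ C ≤ 1 → P.totalDegree ≤ d →
    (∀ n ∈ A, ∀ i, |(n i : ℝ)| ≤ N i) → vol N ≤ K * A.card →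
    (∀ n ∈ A, torusNorm (MvPolynomial.eval (fun i => (n i : ℝ)) P) ≤ ε) →
    ∃ Q : ℕ, 1 ≤ Q ∧ (Q : ℝ) ≤ K ^ C ∧
      ∀ α, torusNorm (Q * P.coeff α) ≤ ε * K ^ C / monom N α

theorem mvRecurrence_zero (d : ℕ) : MvRecurrence 0 d 0 := by
  intro K ε N A P hK _ hε _ _ _ hcard hA
  have hne : A.Nonempty := by
    rw [nonempty_iff_ne_empty]
    rintro rfl
    simp [vol] at hcard
    linarith
  obtain ⟨n, hn⟩ := hne
  refine ⟨1, le_rfl, by simp, fun α => ?_⟩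
  have h1 := hA n hn
  rw [MvPolynomial.eq_C_of_isEmpty P, MvPolynomial.eval_C] at h1
  rw [Subsingleton.elim α 0]
  simpa [monom] using h1

/-- The denominators of the individual polynomials are multiplied together, which costs an exponent
C for each member of J. -/
theorem MvRecurrence.common_denominator {D d C : ℕ} (hC : MvRecurrence D d C) {K : ℝ} (hK : 2 ≤ K)
    {N : Fin D → ℝ} (hN1 : ∀ i, 1 ≤ N i) (hN : ∀ i, K ^ C ≤ N i) {G : Finset (Fin D → ℤ)}
    (hG : ∀ n ∈ G, ∀ i, |(n i : ℝ)| ≤ N i) (hcard : vol N ≤ K * G.card)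
    (p : ℕ → MvPolynomial (Fin D) ℝ) (hp : ∀ j, (p j).totalDegree ≤ d) (ε : ℕ → ℝ) (J : Finset ℕ)
    (hε : ∀ j ∈ J, 0 ≤ ε j) (hεK : ∀ j ∈ J, ε j * K ^ C ≤ 1)
    (hGp : ∀ j ∈ J, ∀ n ∈ G, torusNorm (MvPolynomial.eval (fun i => (n i : ℝ)) (p j)) ≤ ε j) :
    ∃ Q : ℕ, 1 ≤ Q ∧ (Q : ℝ) ≤ K ^ (C * J.card) ∧
      ∀ j ∈ J, ∀ α, torusNorm (Q * (p j).coeff α) ≤ ε j * K ^ (C * J.card) / monom N α := by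
  induction J using Finset.induction_on with
  | empty => exact ⟨1, le_rfl, by simp, by simp⟩
  | insert a J ha ih =>
    obtain ⟨Q, hQ1, hQ2, hQ3⟩ := ih (fun j hj => hε j (mem_insert_of_mem hj))
      (fun j hj => hεK j (mem_insert_of_mem hj)) (fun j hj => hGp j (mem_insert_of_mem hj))
    have haJ := mem_insert_self a J
    obtain ⟨R, hR1, hR2, hR3⟩ := hC K (ε a) N G (p a) hK hN (hε a haJ) (hεK a haJ) (hp a) hG hcard
      (hGp a haJ)
    have hK0 : 0 < K := by linarith
    rw [card_insert_of_notMem ha]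
    refine ⟨Q * R, Nat.mul_pos hQ1 hR1, ?_, ?_⟩
    · push_cast
      calc (Q : ℝ) * R ≤ K ^ (C * J.card) * K ^ C := by gcongr
        _ = _ := by ring
    · intro j hj α
      have hm := monom_pos hN1 α
      rcases mem_insert.1 hj with rfl | hj'
      · push_cast
        rw [mul_assoc]
        calc _ ≤ _ := torusNorm_nat_mul_le _ _
          _ ≤ K ^ (C * J.card) * (ε j * K ^ C / monom N α) := by
            gcongr
            · exact torusNorm_nonneg _
            · exact hR3 α
          _ = _ := by ring
      · push_cast
        rw [mul_comm (Q : ℝ), mul_assoc]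
        calc _ ≤ _ := torusNorm_nat_mul_le _ _
          _ ≤ K ^ C * (ε j * K ^ (C * J.card) / monom N α) := by
            gcongr
            · exact torusNorm_nonneg _
            · exact hQ3 j hj' α
          _ = _ := by ring

/-- One-variable recurrence on rich fibers makes the slice coefficients p_j(n) almost integral after
a common scaling; these are polynomials in n, so induction on D applies to each. -/
theorem mvRecurrence_succ {D d C R : ℕ} (ih : MvRecurrence D d C) (hR : PolyRecurrence d R) :
    ∃ C', MvRecurrence (D + 1) d C' := by
  obtain ⟨a, ha⟩ : ∃ a, a = (2 + 2 * D) * R := ⟨_, rfl⟩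
  obtain ⟨b, hb⟩ : ∃ b, b = (4 + a) * (C * (d + 1)) := ⟨_, rfl⟩
  refine ⟨a + b, ?_⟩
  intro K ε N A P hK hN hε hεK hP hA hcard hT
  have hK0 : 0 < K := by linarith
  have hK1 : 1 ≤ K := by linarith
  have hN1 : ∀ i, 1 ≤ N i := fun i => (one_le_pow₀ hK1).trans (hN i)
  have hN0 : 0 < N 0 := by linarith [hN1 0]
  have hmono : ∀ c ≤ a + b, K ^ c ≤ K ^ (a + b) := fun c hc => pow_le_pow_right₀ hK1 hc
  have hCb : (4 + a) * C ≤ b := by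
    rw [hb, ← mul_assoc]; exact Nat.le_mul_of_pos_right _ (by omega)
  set fib : (Fin D → ℤ) → Finset ℤ := fun n =>
    (A.filter (fun m => Fin.tail m = n)).image (fun m => m 0) with hfib
  have hmem : ∀ n x, x ∈ fib n ↔ Fin.cons x n ∈ A := by
    intro n x
    simp only [hfib, mem_image, mem_filter]
    constructor
    · rintro ⟨m, ⟨hm, rfl⟩, rfl⟩
      rwa [Fin.cons_self_tail]
    · intro h
      exact ⟨_, ⟨h, Fin.tail_cons _ _⟩, Fin.cons_zero _ _⟩
  have hfibcard : ∀ n, (fib n).card = (A.filter (fun m => Fin.tail m = n)).card := by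
    intro n
    apply card_image_of_injOn
    intro m hm m' hm' h
    simp only [coe_filter, Set.mem_ofPred_eq] at hm hm'
    rw [← Fin.cons_self_tail m, ← Fin.cons_self_tail m', hm.2, hm'.2]
    simp only at h
    rw [h]
  have hfibN : ∀ n, ∀ x ∈ fib n, |(x : ℝ)| ≤ N 0 := by
    intro n x hx
    have := hA _ ((hmem n x).1 hx) 0
    simpa using this
  set B := A.image Fin.tail with hB
  have hBN : ∀ n ∈ B, ∀ i, |(n i : ℝ)| ≤ Fin.tail N i := by
    intro n hn i
    obtain ⟨m, hm, rfl⟩ := mem_image.1 hn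
    exact hA m hm i.succ
  have hAcard : (A.card : ℝ) = ∑ n ∈ B, ((fib n).card : ℝ) := by
    rw [card_eq_sum_card_fiberwise (f := Fin.tail) (t := B) (fun m hm => mem_image_of_mem _ hm)]
    push_cast
    simp_rw [hfibcard]
  obtain ⟨G, hGB, hGne, hGcard, hGfib⟩ := exists_good_fibers hK hN1 B hBN
    (fun n => ((fib n).card : ℝ)) (fun n _ => card_le_three_mul _ (hN1 0) (hfibN n))
    (by rw [← hAcard]; exact hcard)
  have hstep : ∀ n ∈ G, ∃ Q : ℕ, 1 ≤ Q ∧ (Q : ℝ) ≤ K ^ a ∧ ∀ j,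
      torusNorm (Q * MvPolynomial.eval (fun i => (n i : ℝ))
        ((MvPolynomial.finSuccEquiv ℝ D P).coeff j)) ≤ ε * K ^ a / N 0 ^ j := by
    intro n hn
    obtain ⟨Q, hQ1, hQ2, hQ3⟩ := hR (K ^ (2 + 2 * D)) (N 0) ε (fib n)
      (Polynomial.map (MvPolynomial.eval (fun i => (n i : ℝ))) (MvPolynomial.finSuccEquiv ℝ D P))
      (by
        calc 2 ≤ K ^ 1 := by simpa using hK
          _ ≤ _ := pow_le_pow_right₀ hK1 (by omega))
      (by
        rw [← pow_mul, ← ha]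
        exact (hmono _ (by omega)).trans (hN 0))
      hε
      (by
        rw [← pow_mul, ← ha]
        exact (mul_le_mul_of_nonneg_left (hmono _ (by omega)) hε).trans hεK)
      (natDegree_slice_le hP _) (hfibN n) (hGfib n hn)
      (by
        intro x hx
        rw [← eval_cons]
        exact hT _ ((hmem n x).1 hx))
    rw [← pow_mul, ← ha] at hQ2 hQ3
    refine ⟨Q, hQ1, hQ2, fun j => ?_⟩
    have := hQ3 j
    rwa [Polynomial.coeff_map] at this
  obtain ⟨Q, hQ1, hQ2, G', hG', hGG', hQ3⟩ := exists_common_denominator G hGne _ hstep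
  obtain ⟨Q2, hQ21, hQ22, hQ23⟩ := ih.common_denominator (K := K ^ (4 + a)) (N := Fin.tail N)
    (G := G')
    (by
      calc 2 ≤ K ^ 1 := by simpa using hK
        _ ≤ _ := pow_le_pow_right₀ hK1 (by omega))
    (fun i => hN1 i.succ)
    (fun i => by
      rw [← pow_mul]
      exact (hmono _ (by omega)).trans (hN i.succ))
    (fun n hn => hBN n (hGB (hG' hn)))
    (by
      calc vol (Fin.tail N) ≤ K ^ 4 * (K ^ a * G'.card) := hGcard.trans (by gcongr)
        _ = K ^ (4 + a) * G'.card := by ring)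
    (fun j => MvPolynomial.C (Q : ℝ) * (MvPolynomial.finSuccEquiv ℝ D P).coeff j)
    (fun j => by
      rw [← MvPolynomial.smul_eq_C_mul]
      exact (MvPolynomial.totalDegree_smul_le _ _).trans (totalDegree_coeff_finSuccEquiv_le hP j))
    (fun j => ε * K ^ a / N 0 ^ j) (range (d + 1))
    (fun j _ => by positivity)
    (fun j _ => by
      rw [← pow_mul, div_mul_eq_mul_div, div_le_one (by positivity)]
      calc ε * K ^ a * K ^ ((4 + a) * C) = ε * K ^ (a + (4 + a) * C) := by ring
        _ ≤ ε * K ^ (a + b) := mul_le_mul_of_nonneg_left (hmono _ (by omega)) hε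
        _ ≤ 1 := hεK
        _ ≤ N 0 ^ j := one_le_pow₀ (hN1 0))
    (fun j _ n hn => by
      rw [MvPolynomial.eval_mul, MvPolynomial.eval_C]
      exact hQ3 n hn j)
  rw [card_range, ← pow_mul, ← hb] at hQ22 hQ23
  refine ⟨Q2 * Q, Nat.mul_pos hQ21 hQ1, ?_, ?_⟩
  · push_cast
    calc (Q2 : ℝ) * Q ≤ K ^ b * K ^ a := by gcongr
      _ = K ^ (a + b) := by ring
  · intro α
    have hm := monom_pos hN1 α
    rw [coeff_eq_coeff_finSuccEquiv]
    by_cases hj : d < α 0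
    · rw [coeff_finSuccEquiv_eq_zero hP hj, MvPolynomial.coeff_zero, mul_zero, torusNorm_zero]
      positivity
    · have h1 := hQ23 (α 0) (mem_range.2 (by omega)) α.tail
      rw [MvPolynomial.coeff_C_mul, ← mul_assoc] at h1
      push_cast
      refine h1.trans (le_of_eq ?_)
      rw [monom_succ, pow_add]
      have : 0 < monom (Fin.tail N) α.tail := monom_pos (fun i => hN1 i.succ) _
      field_simp

theorem exists_mvRecurrence (D d : ℕ) : ∃ C, MvRecurrence D d C := by
  induction D with
  | zero => exact ⟨0, mvRecurrence_zero d⟩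
  | succ D ih =>
    obtain ⟨C, hC⟩ := ih
    obtain ⟨R, hR⟩ := exists_polyRecurrence d
    exact mvRecurrence_succ hC hR

/-! ### Weyl sums in several variables -/

/-- The analogue of `WeylBound` for polynomials in `D` variables. -/
def MvWeylBound (D d C : ℕ) : Prop :=
  ∀ (K : ℝ) (N : Fin D → ℝ) (q : Fin D → ℕ) (S : Fin D → Finset ℤ) (P : MvPolynomial (Fin D) ℝ),
    2 ≤ K → (∀ i, K ^ C ≤ N i) → (∀ i, 1 ≤ q i) → (∀ i, (q i : ℝ) ≤ K) →
    (∀ i, IsSegment (q i) (S i)) → (∀ i, ∀ x ∈ S i, |(x : ℝ)| ≤ N i) → P.totalDegree ≤ d →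
    vol N ≤ K * ‖∑ n ∈ Fintype.piFinset S, e (MvPolynomial.eval (fun i => (n i : ℝ)) P)‖ →
    ∃ Q : ℕ, 1 ≤ Q ∧ (Q : ℝ) ≤ K ^ C ∧ ∀ α, torusNorm (Q * P.coeff α) ≤ K ^ C / monom N α

theorem mvWeylBound_zero (d : ℕ) : MvWeylBound 0 d 0 := by
  intro K N q S P _ _ _ _ _ _ _ _
  refine ⟨1, le_rfl, by simp, fun α => ?_⟩
  simp only [monom, univ_eq_empty, prod_empty, pow_zero, div_one]
  exact (torusNorm_le_half _).trans (by norm_num)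

theorem sum_piFinset_succ {D : ℕ} {M : Type*} [AddCommMonoid M] (S : Fin (D + 1) → Finset ℤ)
    (F : (Fin (D + 1) → ℤ) → M) :
    ∑ n ∈ Fintype.piFinset S, F n =
      ∑ n ∈ Fintype.piFinset (Fin.tail S), ∑ x ∈ S 0, F (Fin.cons x n) := by
  rw [← sum_product']
  refine sum_nbij' (fun n => (Fin.tail n, n 0)) (fun p => Fin.cons p.2 p.1) ?_ ?_ ?_ ?_ ?_
  · intro n hn
    rw [Fintype.mem_piFinset] at hn
    rw [mem_product, Fintype.mem_piFinset]
    exact ⟨fun i => hn i.succ, hn 0⟩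
  · rintro ⟨n, x⟩ h
    rw [mem_product, Fintype.mem_piFinset] at h
    rw [Fintype.mem_piFinset]
    refine Fin.cases ?_ fun i => ?_
    · simpa using h.2
    · simpa [Fin.tail] using h.1 i
  · intro n _
    exact Fin.cons_self_tail n
  · rintro ⟨n, x⟩ _
    simp
  · intro n _
    simp only [Fin.cons_self_tail]

/-- The first coordinate takes at most 3N₀ values, so the best one does at least as well as the
average. -/
theorem exists_large_slice {D : ℕ} {K : ℝ} (hK : 2 ≤ K) {N : Fin (D + 1) → ℝ} (hN : ∀ i, 1 ≤ N i)
    {S : Fin (D + 1) → Finset ℤ} (hS : ∀ i, ∀ x ∈ S i, |(x : ℝ)| ≤ N i)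
    (F : (Fin (D + 1) → ℤ) → ℂ) (hsum : vol N ≤ K * ‖∑ n ∈ Fintype.piFinset S, F n‖) :
    ∃ x ∈ S 0, vol (Fin.tail N) ≤
      K ^ 3 * ‖∑ n ∈ Fintype.piFinset (Fin.tail S), F (Fin.cons x n)‖ := by
  have hK0 : 0 < K := by linarith
  have hN0 : 0 < N 0 := by linarith [hN 0]
  rw [sum_piFinset_succ, sum_comm] at hsum
  have hne : (S 0).Nonempty := by
    rw [nonempty_iff_ne_empty]
    intro h
    rw [h] at hsum
    simp at hsum
    linarith [vol_pos hN]
  obtain ⟨x, hx, hmax⟩ := exists_max_image (S 0)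
    (fun x => ‖∑ n ∈ Fintype.piFinset (Fin.tail S), F (Fin.cons x n)‖) hne
  refine ⟨x, hx, ?_⟩
  set T := ‖∑ n ∈ Fintype.piFinset (Fin.tail S), F (Fin.cons x n)‖
  have hT : 0 ≤ T := norm_nonneg _
  have h1 : vol N ≤ K * (3 * N 0 * T) := by
    refine hsum.trans (mul_le_mul_of_nonneg_left ?_ hK0.le)
    refine (norm_sum_le _ _).trans ((sum_le_card_nsmul _ _ _ hmax).trans ?_)
    rw [nsmul_eq_mul]
    gcongr
    exact card_le_three_mul _ (hN 0) (hS 0)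
  rw [vol_succ] at h1
  have h2 : vol (Fin.tail N) ≤ 3 * K * T := by
    have : N 0 * vol (Fin.tail N) ≤ N 0 * (3 * K * T) := by linarith
    exact le_of_mul_le_mul_left this hN0
  refine h2.trans ?_
  gcongr
  nlinarith [mul_le_mul hK hK (by norm_num) hK0.le]

/-- The polynomial in the last `D` variables obtained by substituting `x` for the first one. -/
noncomputable def evalFirst {D : ℕ} (d : ℕ) (P : MvPolynomial (Fin (D + 1)) ℝ) (x : ℤ) :
    MvPolynomial (Fin D) ℝ :=
  ∑ j ∈ range (d + 1), (x : ℝ) ^ j • (MvPolynomial.finSuccEquiv ℝ D P).coeff j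

theorem totalDegree_evalFirst_le {D d : ℕ} {P : MvPolynomial (Fin (D + 1)) ℝ}
    (hP : P.totalDegree ≤ d) (x : ℤ) : (evalFirst d P x).totalDegree ≤ d := by
  refine (MvPolynomial.totalDegree_finsetSum _ _).trans (Finset.sup_le fun j _ => ?_)
  exact (MvPolynomial.totalDegree_smul_le _ _).trans (totalDegree_coeff_finSuccEquiv_le hP j)

theorem eval_evalFirst {D d : ℕ} {P : MvPolynomial (Fin (D + 1)) ℝ}
    (hP : P.totalDegree ≤ d) (x : ℤ) (n : Fin D → ℤ) :
    MvPolynomial.eval (fun i => (n i : ℝ)) (evalFirst d P x) =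
      MvPolynomial.eval (fun i => ((Fin.cons x n : Fin (D + 1) → ℤ) i : ℝ)) P := by
  rw [eval_cons, Polynomial.eval_eq_sum_range' (Nat.lt_succ_of_le (natDegree_slice_le hP _)),
    evalFirst, map_sum]
  refine sum_congr rfl fun j _ => ?_
  rw [MvPolynomial.smul_eval, Polynomial.coeff_map, mul_comm]

theorem mvWeylBound_succ {D d C R W : ℕ} (ih : MvWeylBound D d C) (hR : MvRecurrence D d R)
    (hW : WeylBound d W) : ∃ C', MvWeylBound (D + 1) d C' := by
  obtain ⟨a, ha⟩ : ∃ a, a = (2 + 2 * D) * W := ⟨_, rfl⟩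
  obtain ⟨b, hb⟩ : ∃ b, b = (4 + a) * (R * d) := ⟨_, rfl⟩
  refine ⟨a + b + (4 + a) * R + 3 * C + (d + 1), ?_⟩
  obtain ⟨E, hE⟩ : ∃ E, E = a + b + (4 + a) * R + 3 * C + (d + 1) := ⟨_, rfl⟩
  rw [← hE]
  intro K N q S P hK hN hq1 hqK hseg hS hP hsum
  have hK0 : 0 < K := by linarith
  have hK1 : 1 ≤ K := by linarith
  have hN1 : ∀ i, 1 ≤ N i := fun i => (one_le_pow₀ hK1).trans (hN i)
  have hN0 : 0 < N 0 := by linarith [hN1 0]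
  have hmono : ∀ c ≤ E, K ^ c ≤ K ^ E := fun c hc => pow_le_pow_right₀ hK1 hc
  have hKpow : ∀ c, 1 ≤ c → K ≤ K ^ c := fun c hc => by
    simpa using pow_le_pow_right₀ hK1 hc
  have hV : ∀ α, 0 < monom (Fin.tail N) α := monom_pos fun i => hN1 i.succ
  set B := Fintype.piFinset (Fin.tail S) with hB
  have hBN : ∀ n ∈ B, ∀ i, |(n i : ℝ)| ≤ Fin.tail N i := by
    intro n hn i
    exact hS i.succ _ (Fintype.mem_piFinset.1 hn i)
  set p := (MvPolynomial.finSuccEquiv ℝ D P).coeff with hp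
  -- the coefficients of the monomials involving the first variable
  obtain ⟨G, hGB, hGne, hGcard, hGfib⟩ := exists_good_fibers hK hN1 B hBN
    (fun n => ‖∑ x ∈ S 0,
      e (MvPolynomial.eval (fun i => ((Fin.cons x n : Fin (D + 1) → ℤ) i : ℝ)) P)‖)
    (fun n _ => by
      refine (norm_sum_le _ _).trans ?_
      simp only [norm_e, sum_const, nsmul_eq_mul, mul_one]
      exact card_le_three_mul _ (hN1 0) (hS 0))
    (by
      refine hsum.trans (mul_le_mul_of_nonneg_left ?_ hK0.le)
      rw [sum_piFinset_succ]
      exact norm_sum_le _ _)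
  have hstep : ∀ n ∈ G, ∃ Q : ℕ, 1 ≤ Q ∧ (Q : ℝ) ≤ K ^ a ∧ ∀ j,
      torusNorm (Q * MvPolynomial.eval (fun i => (n i : ℝ)) (p j)) ≤ K ^ a / N 0 ^ j := by
    intro n hn
    obtain ⟨Q, hQ1, hQ2, hQ3⟩ := hW (K ^ (2 + 2 * D)) (N 0) (q 0) (S 0)
      (Polynomial.map (MvPolynomial.eval (fun i => (n i : ℝ))) (MvPolynomial.finSuccEquiv ℝ D P))
      (hK.trans (hKpow _ (by omega)))
      (by
        rw [← pow_mul, ← ha]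
        exact (hmono _ (by omega)).trans (hN 0))
      (hq1 0) ((hqK 0).trans (hKpow _ (by omega))) (hseg 0) (hS 0) (natDegree_slice_le hP _)
      (by
        simp_rw [← eval_cons]
        exact hGfib n hn)
    rw [← pow_mul, ← ha] at hQ2 hQ3
    refine ⟨Q, hQ1, hQ2, fun j => ?_⟩
    have := hQ3 j
    rwa [Polynomial.coeff_map] at this
  obtain ⟨Q, hQ1, hQ2, G', hG', hGG', hQ3⟩ := exists_common_denominator G hGne _ hstep
  obtain ⟨Q2, hQ21, hQ22, hQ23⟩ := hR.common_denominator (K := K ^ (4 + a)) (N := Fin.tail N)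
    (G := G') (hK.trans (hKpow _ (by omega)))
    (fun i => hN1 i.succ)
    (fun i => by
      rw [← pow_mul]
      exact (hmono _ (by omega)).trans (hN i.succ))
    (fun n hn => hBN n (hGB (hG' hn)))
    (by
      calc vol (Fin.tail N) ≤ K ^ 4 * (K ^ a * G'.card) := hGcard.trans (by gcongr)
        _ = K ^ (4 + a) * G'.card := by ring)
    (fun j => MvPolynomial.C (Q : ℝ) * p j)
    (fun j => by
      rw [← MvPolynomial.smul_eq_C_mul]
      exact (MvPolynomial.totalDegree_smul_le _ _).trans (totalDegree_coeff_finSuccEquiv_le hP j))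
    -- The index 0 is left out: its error K^a has no power of N₀ to make it small, so recurrence
    -- cannot be applied.
    (fun j => K ^ a / N 0 ^ j) (Icc 1 d)
    (fun j _ => by positivity)
    (fun j hj => by
      rw [← pow_mul, div_mul_eq_mul_div, div_le_one (by positivity), ← pow_add]
      calc K ^ (a + (4 + a) * R) ≤ K ^ E := hmono _ (by omega)
        _ ≤ N 0 := hN 0
        _ ≤ N 0 ^ j := by simpa using pow_le_pow_right₀ (hN1 0) (mem_Icc.1 hj).1)
    (fun j _ n hn => by
      rw [MvPolynomial.eval_mul, MvPolynomial.eval_C]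
      exact hQ3 n hn j)
  rw [Nat.card_Icc, Nat.add_sub_cancel, ← pow_mul, ← hb] at hQ22 hQ23
  have hpos : ∀ j ∈ Icc 1 d, ∀ α, torusNorm ((Q2 * Q : ℕ) * (p j).coeff α) ≤
      K ^ (a + b) / (N 0 ^ j * monom (Fin.tail N) α) := by
    intro j hj α
    have h1 := hQ23 j hj α
    rw [MvPolynomial.coeff_C_mul, ← mul_assoc] at h1
    push_cast
    refine h1.trans (le_of_eq ?_)
    rw [pow_add]
    have := hV α
    field_simp
  have hQQ : ((Q2 * Q : ℕ) : ℝ) ≤ K ^ (a + b) := by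
    push_cast
    calc (Q2 : ℝ) * Q ≤ K ^ b * K ^ a := by gcongr
      _ = K ^ (a + b) := by ring
  -- the coefficients of the remaining monomials
  obtain ⟨x, hx, hxsum⟩ := exists_large_slice hK hN1 hS _ hsum
  simp_rw [← eval_evalFirst hP] at hxsum
  obtain ⟨Q0, hQ01, hQ02, hQ03⟩ := ih (K ^ 3) (Fin.tail N) (Fin.tail q) (Fin.tail S)
    (evalFirst d P x) (hK.trans (hKpow _ (by omega)))
    (fun i => by
      rw [← pow_mul]
      exact (hmono _ (by omega)).trans (hN i.succ))
    (fun i => hq1 i.succ) (fun i => (hqK i.succ).trans (hKpow _ (by omega)))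
    (fun i => hseg i.succ) (fun i => hS i.succ) (totalDegree_evalFirst_le hP x) hxsum
  rw [← pow_mul] at hQ02 hQ03
  refine ⟨Q0 * (Q2 * Q), Nat.mul_pos hQ01 (Nat.mul_pos hQ21 hQ1), ?_, ?_⟩
  · rw [Nat.cast_mul]
    calc (Q0 : ℝ) * (Q2 * Q : ℕ) ≤ K ^ (3 * C) * K ^ (a + b) := by gcongr
      _ = K ^ (3 * C + (a + b)) := by ring
      _ ≤ K ^ E := hmono _ (by omega)
  · intro α
    have hm := monom_pos hN1 α
    have hmt := hV α.tail
    rw [coeff_eq_coeff_finSuccEquiv, monom_succ, Nat.cast_mul]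
    obtain hj | hj | hj : d < α 0 ∨ α 0 ∈ Icc 1 d ∨ α 0 = 0 := by
      rw [mem_Icc]; omega
    · rw [coeff_finSuccEquiv_eq_zero hP hj, MvPolynomial.coeff_zero, mul_zero, torusNorm_zero]
      positivity
    · rw [mul_assoc]
      calc _ ≤ _ := torusNorm_nat_mul_le _ _
        _ ≤ K ^ (3 * C) * (K ^ (a + b) / (N 0 ^ α 0 * monom (Fin.tail N) α.tail)) := by
          gcongr
          · exact torusNorm_nonneg _
          · exact hpos _ hj _
        _ = K ^ (3 * C + (a + b)) / (N 0 ^ α 0 * monom (Fin.tail N) α.tail) := by ring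
        _ ≤ _ := by
          gcongr ?_ / _
          exact hmono _ (by omega)
    · rw [hj, pow_zero, one_mul]
      have hcoef : (evalFirst d P x).coeff α.tail =
          ∑ j ∈ Icc 1 d, (x : ℝ) ^ j * (p j).coeff α.tail + (p 0).coeff α.tail := by
        rw [evalFirst, MvPolynomial.coeff_sum, sum_range_succ', range_eq_Ico, sum_Ico_add' (c := 1)
          (f := fun j => MvPolynomial.coeff α.tail ((x : ℝ) ^ j • p j))]
        congr 1
        rw [pow_zero, one_smul]
      -- Solve for the coefficient of p_0 in P(x, ·). In the subtracted terms |x|^j ≤ N₀^j cancels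
      -- the gain N₀^(-j), so the d terms all have the required size.
      have hsplit : (Q0 : ℝ) * (Q2 * Q : ℕ) * (p 0).coeff α.tail =
          (Q2 * Q : ℕ) * (Q0 * (evalFirst d P x).coeff α.tail) -
            ∑ j ∈ Icc 1 d, ((Q0 * x ^ j : ℤ) : ℝ) * ((Q2 * Q : ℕ) * (p j).coeff α.tail) := by
        have h1 : ∑ j ∈ Icc 1 d, ((Q0 * x ^ j : ℤ) : ℝ) * ((Q2 * Q : ℕ) * (p j).coeff α.tail) =
            Q0 * (Q2 * Q : ℕ) * ∑ j ∈ Icc 1 d, (x : ℝ) ^ j * (p j).coeff α.tail := by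
          rw [mul_sum]
          refine sum_congr rfl fun j _ => ?_
          push_cast
          ring
        rw [h1, hcoef]
        ring
      have hterm : ∀ j ∈ Icc 1 d,
          torusNorm (((Q0 * x ^ j : ℤ) : ℝ) * ((Q2 * Q : ℕ) * (p j).coeff α.tail)) ≤
            K ^ (3 * C + (a + b)) / monom (Fin.tail N) α.tail := by
        intro j hj
        refine (torusNorm_int_mul_le _ _).trans ?_
        push_cast
        rw [abs_mul, Nat.abs_cast, abs_pow, ← Nat.cast_mul]
        calc (Q0 : ℝ) * |(x : ℝ)| ^ j * torusNorm ((Q2 * Q : ℕ) * (p j).coeff α.tail)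
            ≤ K ^ (3 * C) * N 0 ^ j *
              (K ^ (a + b) / (N 0 ^ j * monom (Fin.tail N) α.tail)) := by
              gcongr
              · exact torusNorm_nonneg _
              · exact hS 0 x hx
              · exact hpos j hj _
          _ = _ := by
            rw [pow_add _ (3 * C)]
            field_simp
      rw [hsplit]
      calc _ ≤ _ := torusNorm_sub_le _ _
        _ ≤ K ^ (3 * C + (a + b)) / monom (Fin.tail N) α.tail +
            d * (K ^ (3 * C + (a + b)) / monom (Fin.tail N) α.tail) := by
          refine add_le_add ?_ ?_
          · calc _ ≤ _ := torusNorm_nat_mul_le _ _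
              _ ≤ K ^ (a + b) * (K ^ (3 * C) / monom (Fin.tail N) α.tail) := by
                gcongr
                · exact torusNorm_nonneg _
                · exact hQ03 _
              _ = _ := by ring
          · refine (torusNorm_sum_le _ _).trans ((sum_le_card_nsmul _ _ _ hterm).trans ?_)
            rw [Nat.card_Icc, Nat.add_sub_cancel, nsmul_eq_mul]
        _ = ((d + 1 : ℕ) : ℝ) * K ^ (3 * C + (a + b)) / monom (Fin.tail N) α.tail := by
          push_cast
          ring
        _ ≤ K ^ (d + 1) * K ^ (3 * C + (a + b)) / monom (Fin.tail N) α.tail := by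
          gcongr
          exact natCast_le_pow hK _
        _ = K ^ (d + 1 + (3 * C + (a + b))) / monom (Fin.tail N) α.tail := by
          rw [← pow_add]
        _ ≤ _ := by
          gcongr ?_ / _
          exact hmono _ (by omega)

theorem exists_mvWeylBound (D d : ℕ) : ∃ C, MvWeylBound D d C := by
  induction D with
  | zero => exact ⟨0, mvWeylBound_zero d⟩
  | succ D ih =>
    obtain ⟨C, hC⟩ := ih
    obtain ⟨R, hR⟩ := exists_mvRecurrence D d
    obtain ⟨W, hW⟩ := exists_weylBound d
    exact mvWeylBound_succ hC hR hW

/-! ### Arithmetic progressions of bounded gap -/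

theorem exists_gap_eq {S : Finset ℤ} (hS : 1 < S.card) :
    ∃ p ∈ S, ∃ p' ∈ S, p ≠ p' ∧ gap S = (p - p').natAbs := by
  obtain ⟨p, hp, p', hp', hne⟩ := one_lt_card.1 hS
  exact Nat.sInf_mem (s := {k : ℕ | ∃ p ∈ S, ∃ p' ∈ S, p ≠ p' ∧ k = (p - p').natAbs})
    ⟨_, p, hp, p', hp', hne, rfl⟩

theorem card_le_one_of_gap_lt_one {S : Finset ℤ} (hS : gap S < 1) : S.card ≤ 1 := by
  by_contra h
  obtain ⟨p, _, p', _, hne, hg⟩ := exists_gap_eq (not_le.1 h)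
  have := Int.natAbs_pos.2 (sub_ne_zero.2 hne)
  omega

/-- With two or more elements every difference is a multiple of the step, so the step is at most the
gap. Otherwise the gap is 0 and step 1 is used, whence the maximum. -/
theorem IsArithProg.exists_isSegment {S : Finset ℤ} (hS : IsArithProg S) :
    ∃ q : ℕ, 1 ≤ q ∧ q ≤ max 1 (gap S) ∧ IsSegment q S := by
  by_cases hcard : S.card ≤ 1
  · refine ⟨1, le_rfl, le_max_left _ _, ?_⟩
    rcases Nat.le_one_iff_eq_zero_or_eq_one.1 hcard with h | h
    · rw [card_eq_zero] at h
      exact ⟨1, 0, 0, by simp [h]⟩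
    · obtain ⟨x, rfl⟩ := card_eq_one.1 h
      exact ⟨x, x, 0, by simp⟩
  · obtain ⟨a, q, L, hq, hSeq⟩ := hS
    have hq0 : (0 : ℤ) < q := by exact_mod_cast hq
    refine ⟨q, hq, ?_, a, a + (L - 1) * q, a, ?_⟩
    · obtain ⟨p, hp, p', hp', hne, hg⟩ := exists_gap_eq (not_le.1 hcard)
      refine le_trans ?_ (le_max_right _ _)
      rw [hg]
      rw [hSeq] at hp hp'
      obtain ⟨k, _, rfl⟩ := mem_image.1 hp
      obtain ⟨k', _, rfl⟩ := mem_image.1 hp'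
      apply Nat.le_of_dvd (Int.natAbs_pos.2 (sub_ne_zero.2 hne))
      rw [← Int.natCast_dvd]
      exact ⟨k - k', by ring⟩
    · ext n
      rw [hSeq, mem_image, mem_filter, mem_Icc]
      constructor
      · rintro ⟨k, hk, rfl⟩
        have hk := mem_range.1 hk
        have h1 : (k : ℤ) ≤ L - 1 := by omega
        refine ⟨⟨le_add_of_nonneg_right (by positivity), ?_⟩, ⟨k, by ring⟩⟩
        gcongr
      · rintro ⟨⟨h1, h2⟩, k, hk⟩
        have h3 : 0 ≤ k := by
          by_contra h
          have : (q : ℤ) * k < 0 := mul_neg_of_pos_of_neg hq0 (not_le.1 h)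
          omega
        have h4 : k ≤ L - 1 := by
          have : (q : ℤ) * k ≤ q * (L - 1) := by linarith
          exact le_of_mul_le_mul_left this hq0
        refine ⟨k.toNat, mem_range.2 (by omega), ?_⟩
        rw [Int.toNat_of_nonneg h3]
        linarith

theorem norm_normalizedSum_le_one {D : ℕ} {N : Fin D → ℝ} (hN : ∀ i, 1 ≤ N i)
    {S : Fin D → Finset ℤ} (hS : ∀ i, (S i).card ≤ 1) (P : MvPolynomial (Fin D) ℝ) :
    ‖normalizedSum N S P‖ ≤ 1 := by
  have hV : 1 ≤ vol N := by
    unfold vol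
    exact one_le_prod fun i _ => hN i
  have hcard : ((Fintype.piFinset S).card : ℝ) ≤ 1 := by
    rw [Fintype.card_piFinset]
    exact_mod_cast prod_le_one' fun i _ => hS i
  unfold normalizedSum
  rw [norm_mul, norm_div, norm_one, Complex.norm_real, Real.norm_eq_abs, abs_of_pos (by linarith)]
  have h1 : ‖∑ n ∈ Fintype.piFinset S, e (MvPolynomial.eval (fun i => (n i : ℝ)) P)‖ ≤ 1 := by
    refine (norm_sum_le _ _).trans ?_
    simpa [norm_e] using hcard
  calc 1 / vol N * _ ≤ 1 * 1 := by
        gcongr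
        rw [div_le_one (by linarith)]
        exact hV
    _ = 1 := one_mul _

end ExpSum


/-! ### From powers of K = 2/δ to the stated bounds -/

theorem theoremt (d D : ℕ) :
    ∃ C : ℝ, 0 < C ∧
      ∀ (δ : ℝ) (N : Fin D → ℝ) (S : Fin D → Finset ℤ) (P : MvPolynomial (Fin D) ℝ),
        0 < δ →
        (∀ i, 1 ≤ N i) →
        P.totalDegree ≤ d →
        (∀ i, ExpSum.IsArithProg (S i)) →
        (∀ i, ∀ p ∈ S i, |(p : ℝ)| ≤ N i) →
        (∀ i, (ExpSum.gap (S i) : ℝ) ≤ δ⁻¹) →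
        δ ≤ ‖ExpSum.normalizedSum N S P‖ →
        (∃ i, N i ≤ C * δ ^ (-C)) ∨
        (∃ Q : ℕ, 1 ≤ Q ∧ (Q : ℝ) ≤ C * δ ^ (-C) ∧
          ∀ α : Fin D →₀ ℕ,
            ExpSum.torusNorm ((Q : ℝ) * MvPolynomial.coeff α P) ≤
              C * δ ^ (-C) / ExpSum.monom N α) := by
  obtain ⟨C, hC⟩ := ExpSum.exists_mvWeylBound D d
  -- The same number serves as factor and exponent: (2/δ)^C = 2^C·δ^(-C), and C ≤ 2^C with δ ≤ 1.
  refine ⟨2 ^ C, by positivity, ?_⟩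
  intro δ N S P hδ hN hP hAP hS hgap hsum
  -- If δ > 1, every gap is below 1, so each progression has at most one element and the normalized
  -- sum is at most 1, a contradiction.
  have hδ1 : δ ≤ 1 := by
    by_contra h
    have h := not_le.1 h
    refine absurd (hsum.trans (ExpSum.norm_normalizedSum_le_one hN (fun i => ?_) P)) (not_le.2 h)
    apply ExpSum.card_le_one_of_gap_lt_one
    exact_mod_cast (hgap i).trans_lt (inv_lt_one_of_one_lt₀ h)
  have hinv : 1 ≤ δ⁻¹ := (one_le_inv₀ hδ).2 hδ1
  have hKC : (2 * δ⁻¹) ^ C ≤ 2 ^ C * δ ^ (-(2 : ℝ) ^ C) := by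
    rw [mul_pow]
    gcongr
    rw [← Real.rpow_natCast, ← Real.rpow_neg_one, ← Real.rpow_mul hδ.le]
    apply Real.rpow_le_rpow_of_exponent_ge hδ hδ1
    have : (C : ℝ) ≤ 2 ^ C := ExpSum.natCast_le_pow le_rfl C
    linarith
  by_cases hbig : ∀ i, (2 * δ⁻¹) ^ C ≤ N i
  · right
    choose q hq1 hq2 hq3 using fun i => (hAP i).exists_isSegment
    obtain ⟨Q, hQ1, hQ2, hQ3⟩ := hC (2 * δ⁻¹) N q S P (by linarith) hbig hq1
      (fun i => by
        have h1 : (q i : ℝ) ≤ max 1 (ExpSum.gap (S i) : ℝ) := by exact_mod_cast hq2 i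
        have h2 : max 1 (ExpSum.gap (S i) : ℝ) ≤ δ⁻¹ := max_le hinv (hgap i)
        linarith)
      hq3 hS hP
      (by
        have hV := ExpSum.vol_pos hN
        unfold ExpSum.normalizedSum at hsum
        rw [norm_mul, norm_div, norm_one, Complex.norm_real, Real.norm_eq_abs, abs_of_pos hV,
          one_div_mul_eq_div, le_div_iff₀ hV] at hsum
        have h1 : ExpSum.vol N ≤ δ⁻¹ * ‖∑ n ∈ Fintype.piFinset S,
            ExpSum.e (MvPolynomial.eval (fun i => (n i : ℝ)) P)‖ := by
          rw [inv_mul_eq_div, le_div_iff₀ hδ]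
          linarith
        linarith)
    exact ⟨Q, hQ1, hQ2.trans hKC, fun α => (hQ3 α).trans
      (div_le_div_of_nonneg_right hKC (ExpSum.monom_pos hN α).le)⟩
  · left
    push Not at hbig
    obtain ⟨i, hi⟩ := hbig
    exact ⟨i, hi.le.trans hKC⟩
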